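/- Let $(A,\mathfrak m)$ be a noetherian local domain and let $0\neq f\in\mathfrak m$ be such that $A$ is $f$-adically complete. Let $V=\mathrm{Spec}(A)\setminus\{\mathfrak m\}$ be the punctured spectrum of $A$ and let $V_0=\mathrm{Spec}(A/f)\setminus\{\mathfrak m\}$ be the punctured spectrum of $A/f$, i.e. the reduction of $V$ modulo $f$. Assume that $H^0(V,\mathcal O_V)$ is a finite $A$-module and that $f^N\cdot H^1(V,\mathcal O_V)=0$ for some $N\geq 0$. Then $V$ and $V_0$ are non-empty and connected, and for every geometric point $\bar x$ of $V_0$ the natural map of étale fundamental groups $$\pi_1^{\mathrm{\acute{e}t}}(V_0,\bar x)\to\pi_1^{\mathrm{\acute{e}t}}(V,\bar x)$$ induced by the closed immersion $V_0\hookrightarrow V$ is surjective. -/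

import Mathlib

open CategoryTheory AlgebraicGeometry Limits Opposite TopologicalSpace

universe u

noncomputable section

/-! ### Étale fundamental groups -/

/-- The class of finite étale morphisms of schemes. -/
abbrev finiteEtale : MorphismProperty Scheme.{u} := fun _ _ f ↦ IsFinite f ∧ Etale f

instance : finiteEtale.{u}.IsStableUnderBaseChange :=
  MorphismProperty.IsStableUnderBaseChange.inf (P := @IsFinite) (Q := @Etale)

/-- The category of finite étale covers of a scheme `X`, with all `X`-morphisms. -/
abbrev FEt (X : Scheme.{u}) : Type (u + 1) := finiteEtale.{u}.Over ⊤ X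

/-- The fibre functor of a geometric point `x : S = Spec Ω ⟶ X`: it sends a finite étale cover `Y`
of `X` to the set of points of the geometric fibre `Y ×[X] Spec Ω`, i.e. to the set of lifts of `x`
to `Y`. -/
def fiberFunctor (X : Scheme.{u}) {S : Scheme.{u}} (x : S ⟶ X) : FEt X ⥤ Type u where
  obj Y := {y : S ⟶ Y.left // y ≫ Y.hom = x}
  map g := TypeCat.ofHom fun y ↦ ⟨y.1 ≫ g.left, by
    rw [Category.assoc, MorphismProperty.Over.w, y.2]⟩

/-- The étale fundamental group `π₁(X, x)` of a scheme at a geometric point: the automorphism group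
of the fibre functor at `x` on the category of finite étale covers of `X`. -/
abbrev EtalePi1 (X : Scheme.{u}) {S : Scheme.{u}} (x : S ⟶ X) : Type (u + 1) :=
  Aut (fiberFunctor X x)

/-- Base change of finite étale covers along a morphism of schemes. -/
abbrev FEt.baseChange {X' X : Scheme.{u}} (g : X' ⟶ X) : FEt X ⥤ FEt X' :=
  MorphismProperty.Over.pullback finiteEtale ⊤ g

/-- The lifts to `Y ×[X] X'` of a geometric point `x` of `X'` correspond to the lifts to `Y` of its
image in `X` (universal property of the fibre product). -/
def fiberBaseChangeEquiv {X' X : Scheme.{u}} (g : X' ⟶ X) {S : Scheme.{u}} (x : S ⟶ X')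
    {Y : Scheme.{u}} (p : Y ⟶ X) :
    {y : S ⟶ pullback p g // y ≫ pullback.snd p g = x} ≃ {y : S ⟶ Y // y ≫ p = x ≫ g} where
  toFun y := ⟨y.1 ≫ pullback.fst p g, by
    rw [Category.assoc, pullback.condition, ← Category.assoc, y.2]⟩
  invFun y := ⟨pullback.lift y.1 x y.2, pullback.lift_snd _ _ _⟩
  left_inv y := Subtype.ext <| pullback.hom_ext
    (pullback.lift_fst _ _ _) ((pullback.lift_snd _ _ _).trans y.2.symm)
  right_inv y := Subtype.ext (pullback.lift_fst _ _ _)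

/-- The fibre functor at the image of `x` in `X` is base change to `X'` followed by the fibre
functor at `x`. -/
def fiberBaseChangeIso {X' X : Scheme.{u}} (g : X' ⟶ X) {S : Scheme.{u}} (x : S ⟶ X') :
    FEt.baseChange g ⋙ fiberFunctor X' x ≅ fiberFunctor X (x ≫ g) :=
  NatIso.ofComponents (fun Y ↦ (fiberBaseChangeEquiv g x Y.hom).toIso) (fun {Y Z} f ↦ by
    ext y
    apply Subtype.ext
    have h : pullback.lift (pullback.fst Y.hom g ≫ f.left) (pullback.snd Y.hom g)
        (by rw [Category.assoc, MorphismProperty.Over.w, pullback.condition]) ≫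
          pullback.fst Z.hom g = pullback.fst Y.hom g ≫ f.left := pullback.lift_fst _ _ _
    exact (Category.assoc y.1 _ _).trans
      ((congrArg (fun t ↦ y.1 ≫ t) h).trans (Category.assoc y.1 _ _).symm))

/-- The homomorphism `π₁(X', x) → π₁(X, g ∘ x)` induced by a morphism of schemes `g : X' ⟶ X`:
an automorphism of the fibre functor of `X'` acts on the fibre of a cover of `X` through the
base change of that cover to `X'`. -/
def EtalePi1.map {X' X : Scheme.{u}} (g : X' ⟶ X) {S : Scheme.{u}} (x : S ⟶ X') :
    EtalePi1 X' x →* EtalePi1 X (x ≫ g) where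
  toFun σ := (fiberBaseChangeIso g x).symm ≪≫
    Functor.isoWhiskerLeft (FEt.baseChange g) σ ≪≫ fiberBaseChangeIso g x
  map_one' := by
    change _ ≪≫ Functor.isoWhiskerLeft _ (Iso.refl _) ≪≫ _ = Iso.refl _
    ext1
    simp
  map_mul' σ τ := by
    have h (a b : fiberFunctor X' x ≅ fiberFunctor X' x) :
        (fiberBaseChangeIso g x).symm ≪≫ Functor.isoWhiskerLeft (FEt.baseChange g) (a ≪≫ b) ≪≫
          fiberBaseChangeIso g x =
        ((fiberBaseChangeIso g x).symm ≪≫ Functor.isoWhiskerLeft (FEt.baseChange g) a ≪≫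
          fiberBaseChangeIso g x) ≪≫
        ((fiberBaseChangeIso g x).symm ≪≫ Functor.isoWhiskerLeft (FEt.baseChange g) b ≪≫
          fiberBaseChangeIso g x) := by
      ext1
      simp
    exact h τ σ

/-! ### Cohomology of the structure sheaf -/

/-- The structure sheaf of a scheme, as a sheaf of abelian groups. -/
def structureAbSheaf (X : Scheme.{u}) :
    Sheaf (Opens.grothendieckTopology X) AddCommGrpCat.{u} :=
  (sheafCompose _ (forget₂ CommRingCat.{u} RingCat.{u} ⋙ forget₂ RingCat.{u} AddCommGrpCat.{u})).obj
    X.sheaf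

/-- Multiplication by a global function `a`, as an endomorphism of the structure sheaf. -/
def mulStructureAbSheaf {X : Scheme.{u}} (a : Γ(X, ⊤)) :
    structureAbSheaf X ⟶ structureAbSheaf X where
  hom :=
    { app := fun U ↦ AddCommGrpCat.ofHom
        (AddMonoidHom.mulLeft (X.presheaf.map (homOfLE (le_top : U.unop ≤ ⊤)).op a))
      naturality := fun U W i ↦ by
        ext (s : X.presheaf.obj U)
        change X.presheaf.map (homOfLE le_top).op a * X.presheaf.map i s =
          X.presheaf.map i (X.presheaf.map (homOfLE le_top).op a * s)
        rw [map_mul, ← CommRingCat.comp_apply, ← Functor.map_comp]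
        rfl }

/-- The cohomology group `Hⁱ(X, 𝒪_X)`: sheaf cohomology, as a derived functor, of the structure
sheaf on the underlying space of `X`. -/
abbrev structureCohomology (X : Scheme.{u}) (i : ℕ) : Type u :=
  Sheaf.H.{u} (structureAbSheaf X) i

/-- Multiplication by a global function `a` on `Hⁱ(X, 𝒪_X)`, by functoriality of cohomology. -/
def mulStructureCohomology {X : Scheme.{u}} (a : Γ(X, ⊤)) (i : ℕ) :
    structureCohomology X i →+ structureCohomology X i :=
  Sheaf.H.map (mulStructureAbSheaf a) i

/-! ### Punctured spectra -/

section Punctured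

variable (A : Type u) [CommRing A] [IsLocalRing A]

/-- The punctured spectrum `V = Spec A ∖ {𝔪}` of a local ring, as an open subset of `Spec A`
(and thereby as a scheme). -/
def puncturedSpec : (Spec (.of A)).Opens :=
  ⟨{IsLocalRing.closedPoint A}ᶜ, (IsLocalRing.isClosed_singleton_closedPoint A).isOpen_compl⟩

/-- The structure map `A → H⁰(V, 𝒪_V)`. -/
def toGlobalPuncturedSpec : A →+* Γ((puncturedSpec A).toScheme, ⊤) :=
  (puncturedSpec A).ι.appTop.hom.comp (Scheme.ΓSpecIso (.of A)).inv.hom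

variable {A}

/-- The closed immersion `Spec (A / f) ⟶ Spec A`. -/
def specQuotient (f : A) : Spec (.of (A ⧸ Ideal.span {f})) ⟶ Spec (.of A) :=
  Spec.map (CommRingCat.ofHom (Ideal.Quotient.mk (Ideal.span {f})))

/-- The reduction `V₀` of `V` modulo `f`: the preimage of `V` in `Spec (A / f)`, which for `f ∈ 𝔪`
is the punctured spectrum `Spec (A / f) ∖ {𝔪}` of `A / f`. -/
def puncturedSpecQuotient (f : A) : (Spec (.of (A ⧸ Ideal.span {f}))).Opens :=
  specQuotient f ⁻¹ᵁ puncturedSpec A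

/-- The closed immersion `V₀ ⟶ V`, the restriction of `Spec (A / f) ⟶ Spec A`. -/
def puncturedSpecQuotientMap (f : A) :
    (puncturedSpecQuotient f).toScheme ⟶ (puncturedSpec A).toScheme :=
  specQuotient f ∣_ puncturedSpec A

end Punctured

end

/-! Surjectivity on `π₁` reduces to one geometric fact: if `W → V` is finite étale and `W` is
connected, so is its reduction `W₀ = W ×_V V₀`. This is a statement about idempotent functions.

Suppose that `H⁰(W, 𝒪)` is finite over `A` and that `f^N` kills `H¹(W, 𝒪)`. An idempotent `e` on
`W₀` lifts, on the members of an affine cover, to functions `b i` that are idempotent modulo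
`f^(N+1)`. Such lifts are unique modulo `f^(N+1)`, so `b i - b j = f^(N+1) c i j` with `c` a
cocycle. Now `f^N c` is the coboundary of some `d`, and the functions `b i - f d i` glue to a global
lift `t` of `e`. As `H⁰(W, 𝒪)` is `f`-adically complete, `t` can be corrected to an idempotent
(`IsLatticeCover.exists_lift_idempotent`), which is trivial because `W` is connected. Nakayama's
lemma shows that `W₀` is not empty.

Both assumptions pass from `V` to `W` because the direct image of `𝒪_W` is locally a direct summand
of a free module. With denominators cleared, the local splittings embed it into a power of `𝒪_V`,
with a quotient `Q` of the same local kind. Hence `H⁰(W, 𝒪)` and `H⁰(Q)` embed into powers of `H⁰(V,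
𝒪)`. In `H⁰(𝒪_V)^σ → H⁰(Q) → H¹(W, 𝒪) → H¹(V, 𝒪)^σ` the first map becomes surjective on the affine
open `D(f)`, so a power of `f` kills its cokernel, and a further power kills `H¹(W, 𝒪)`
(`exists_cechAnnihilated`). Since `A` is a domain, all sections can be compared inside the sections
over one small open `D(h)`; sheaves become lattices and cochains become families of elements of one
module.

For `π₁`, an automorphism `σ` of the fibre functor of `V` is lifted point by point. The admissible
images of a point of a cover of `V₀` are those compatible with `σ` under all maps to covers of `V`.
Connectedness makes these finite sets nonempty, and compactness allows a simultaneous natural choice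
(`EtalePi1.map_surjective`). -/

/-! ### Lattices, their localizations and their first Čech cohomology -/

section Lattice

variable {A : Type*} [CommRing A] {K V : Type*} [AddCommGroup K] [Module A K]
  [AddCommGroup V] [Module A V] {ι : Type}

/-- The elements of an ambient module that are carried into `M` by a power of `a`. If `a` acts
bijectively on the ambient module, this is the localization of `M` away from `a`. -/
def Submodule.awaySaturation (a : A) (M : Submodule A V) : Submodule A V where
  carrier := {v | ∃ n : ℕ, a ^ n • v ∈ M}
  zero_mem' := ⟨0, by simp⟩
  add_mem' := by
    rintro x y ⟨n, hn⟩ ⟨m, hm⟩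
    refine ⟨n + m, ?_⟩
    rw [smul_add]
    refine M.add_mem ?_ ?_
    · rw [add_comm, pow_add, mul_smul]
      exact M.smul_mem _ hn
    · rw [pow_add, mul_smul]
      exact M.smul_mem _ hm
  smul_mem' := by
    rintro c x ⟨n, hn⟩
    refine ⟨n, ?_⟩
    rw [smul_comm]
    exact M.smul_mem _ hn

lemma Submodule.le_awaySaturation (a : A) (M : Submodule A V) : M ≤ M.awaySaturation a :=
  fun _ hv ↦ ⟨0, by simpa using hv⟩

/-- A linear map carrying `M` into `N` carries saturations into saturations. -/
lemma Submodule.map_mem_awaySaturation {a : A} {M : Submodule A V} {N : Submodule A K}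
    (s : V →ₗ[A] K) (hs : ∀ x ∈ M, s x ∈ N) {x : V} (hx : x ∈ M.awaySaturation a) :
    s x ∈ N.awaySaturation a := by
  obtain ⟨n, hn⟩ := hx
  exact ⟨n, by rw [← map_smul]; exact hs _ hn⟩

lemma Submodule.mem_awaySaturation_of_smul {a : A} {M : Submodule A V} {x : V} {n : ℕ}
    (hx : a ^ n • x ∈ M.awaySaturation a) : x ∈ M.awaySaturation a := by
  obtain ⟨m, hm⟩ := hx
  exact ⟨m + n, by rwa [pow_add, mul_smul]⟩

/-- The power of a submodule. -/
abbrev Submodule.power (O : Submodule A K) (σ : Type) : Submodule A (σ → K) :=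
  Submodule.pi Set.univ fun _ ↦ O

lemma Submodule.mem_awaySaturation_power {a : A} {O : Submodule A K} {σ : Type} [Finite σ]
    {x : σ → K} : x ∈ (O.power σ).awaySaturation a ↔ ∀ k, x k ∈ O.awaySaturation a := by
  constructor
  · intro hx k
    exact Submodule.map_mem_awaySaturation (N := O) (LinearMap.proj (φ := fun _ ↦ K) k)
      (fun y (hy : y ∈ O.power σ) ↦ hy k trivial) hx
  · intro hx
    classical
    cases nonempty_fintype σ
    choose n hn using hx
    refine ⟨∑ k, n k, fun k _ ↦ ?_⟩
    rw [Pi.smul_apply, ← Finset.sum_erase_add _ _ (Finset.mem_univ k), pow_add, mul_smul]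
    exact O.smul_mem _ (hn k)

/-- `M` becomes a direct summand of a finite power of `O` after inverting `a`. -/
def IsAwayRetract (O : Submodule A K) (M : Submodule A V) (a : A) : Prop :=
  ∃ (σ : Type) (_ : Finite σ) (p : ℕ) (s : V →ₗ[A] (σ → K)) (r : (σ → K) →ₗ[A] V),
    (∀ x ∈ M, s x ∈ O.power σ) ∧ (∀ y ∈ O.power σ, r y ∈ M) ∧ ∀ x, r (s x) = a ^ p • x

/-- Local retractions onto `M` may be assumed to have the same section. -/
lemma exists_common_section [Finite ι] {g : ι → A} {O : Submodule A K} {M : Submodule A V}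
    (h : ∀ i, IsAwayRetract O M (g i)) :
    ∃ (σ : Type) (_ : Finite σ) (s : V →ₗ[A] (σ → K)), (∀ x ∈ M, s x ∈ O.power σ) ∧
      ∀ i, ∃ (p : ℕ) (r : (σ → K) →ₗ[A] V), (∀ y ∈ O.power σ, r y ∈ M) ∧
        ∀ x, r (s x) = g i ^ p • x := by
  choose σ hσ p s r hs hr hrs using h
  refine ⟨Σ i, σ i, inferInstance, LinearMap.pi fun k ↦ LinearMap.proj (φ := fun _ ↦ K) k.2 ∘ₗ s k.1,
    fun x hx k _ ↦ hs k.1 x hx k.2 trivial, fun i ↦ ⟨p i,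
      r i ∘ₗ LinearMap.pi fun k ↦ LinearMap.proj (φ := fun _ ↦ K) ⟨i, k⟩, fun y hy ↦ ?_, fun x ↦ ?_⟩⟩
  · exact hr i _ fun k _ ↦ hy ⟨i, k⟩ trivial
  · exact hrs i x

/-- The global sections of a lattice: the elements lying in all the localizations. -/
def Submodule.sections (g : ι → A) (M : Submodule A V) : Submodule A V :=
  ⨅ i, M.awaySaturation (g i)

lemma Submodule.mem_sections {g : ι → A} {M : Submodule A V} {x : V} :
    x ∈ M.sections g ↔ ∀ i, x ∈ M.awaySaturation (g i) := by
  simp [Submodule.sections]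

/-- The first Čech cohomology of a lattice is killed by `a`. -/
def CechAnnihilated (g : ι → A) (M : Submodule A V) (a : A) : Prop :=
  ∀ c : ι → ι → V, (∀ i j, c i j ∈ M.awaySaturation (g i * g j)) →
    (∀ i j k, c i j + c j k = c i k) →
    ∃ d : ι → V, (∀ i, d i ∈ M.awaySaturation (g i)) ∧ ∀ i j, a • c i j = d i - d j

lemma eq_zero_of_pow_smul {a : A} (hinj : ∀ x : V, a • x = 0 → x = 0) (n : ℕ) {x : V}
    (hx : a ^ n • x = 0) : x = 0 := by
  induction n with
  | zero => simpa using hx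
  | succ n ih => exact ih (hinj _ (by rwa [smul_smul, ← pow_succ']))

/-- The common section is injective, since composed with a retraction it is multiplication by a
power of the regular element `g i₀`. It embeds the sections of `M` into a finite power of those of
`O`, which is a noetherian module. -/
lemma fg_sections [IsNoetherianRing A] [Finite ι] {g : ι → A} {O : Submodule A K}
    {M : Submodule A V} (hO : (O.sections g).FG) (h : ∀ i, IsAwayRetract O M (g i))
    (i₀ : ι) (hinj : ∀ x : V, g i₀ • x = 0 → x = 0) : (M.sections g).FG := by
  obtain ⟨σ, _, s, hs, hr⟩ := exists_common_section h
  have hfg : ((O.sections g).power σ).FG := Submodule.fg_pi fun _ ↦ hO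
  have hsinj : Function.Injective s := by
    rw [injective_iff_map_eq_zero]
    intro x hx
    obtain ⟨p, r, -, hrs⟩ := hr i₀
    exact eq_zero_of_pow_smul hinj p (by rw [← hrs, hx, map_zero])
  refine Submodule.fg_of_fg_map_injective s hsinj (hfg.of_le ?_)
  rintro _ ⟨x, hx, rfl⟩ k -
  rw [SetLike.mem_coe, Submodule.mem_sections] at hx
  rw [SetLike.mem_coe, Submodule.mem_sections]
  intro i
  exact Submodule.map_mem_awaySaturation (LinearMap.proj (φ := fun _ ↦ K) k ∘ₗ s)
    (fun y hy ↦ hs y hy k trivial) (hx i)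

/-- A finitely generated module contained in the `a`-saturation of `N` is carried into `N` by a
single power of `a`. -/
lemma exists_pow_smul_mem {a : A} {M N : Submodule A V} (hM : M.FG)
    (h : M ≤ N.awaySaturation a) : ∃ n : ℕ, ∀ x ∈ M, a ^ n • x ∈ N := by
  obtain ⟨t, rfl⟩ := hM
  have h' : ∀ x : t, ∃ n : ℕ, a ^ n • (x : V) ∈ N := fun x ↦ h (Submodule.subset_span x.2)
  choose n hn using h'
  refine ⟨∑ x, n x, fun x hx ↦ ?_⟩
  have : Submodule.span A (t : Set V) ≤ N.comap (LinearMap.lsmul A V (a ^ ∑ x, n x)) := by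
    classical
    rw [Submodule.span_le]
    intro y hy
    change a ^ (∑ x, n x) • y ∈ N
    rw [← Finset.sum_erase_add _ _ (Finset.mem_univ (⟨y, hy⟩ : t)), pow_add, mul_smul]
    exact N.smul_mem _ (hn ⟨y, hy⟩)
  exact this hx

/-- If the global sections of `O` are finite and the first Čech cohomology of `O` is killed by a
power of `f`, then the same holds for every lattice which is locally a direct summand of a power
of `O`. -/
theorem exists_cechAnnihilated [IsNoetherianRing A] [Finite ι] {g : ι → A} {O : Submodule A K}
    {M : Submodule A V} (hO : (O.sections g).FG) (h : ∀ i, IsAwayRetract O M (g i))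
    (i₀ : ι) (hK : ∀ x : K, g i₀ • x = 0 → x = 0) (hV : ∀ x : V, g i₀ • x = 0 → x = 0)
    (hV' : ∀ x : V, ∃ y, g i₀ • y = x) {N : ℕ} (hN : CechAnnihilated g O (g i₀ ^ N)) :
    ∃ N' : ℕ, CechAnnihilated g M (g i₀ ^ N') := by
  obtain ⟨σ, _, s, hs, hr⟩ := exists_common_section h
  set f := g i₀
  have hsinj : Function.Injective s := by
    rw [injective_iff_map_eq_zero]
    intro x hx
    obtain ⟨p, r, -, hrs⟩ := hr i₀
    exact eq_zero_of_pow_smul hV p (by rw [← hrs, hx, map_zero])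
  let q := (LinearMap.range s).mkQ
  let Q : Submodule A ((σ → K) ⧸ LinearMap.range s) := (O.power σ).map q
  -- The complementary projection `g i ^ p - s ∘ r` vanishes on the range of `s`, because `r ∘ s = g
  -- i ^ p`. It therefore descends to a section of the quotient map up to `g i ^ p`.
  have hQ : ∀ i, IsAwayRetract O Q (g i) := by
    intro i
    obtain ⟨p, r, hrm, hrs⟩ := hr i
    refine ⟨σ, inferInstance, p, (LinearMap.range s).liftQ
      (LinearMap.lsmul A (σ → K) (g i ^ p) - s ∘ₗ r) ?_, q, ?_, ?_, ?_⟩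
    · rintro _ ⟨x, rfl⟩
      simp [hrs]
    · rintro _ ⟨y, hy, rfl⟩
      exact (O.power σ).sub_mem ((O.power σ).smul_mem _ hy) (hs _ (hrm _ hy))
    · exact fun y hy ↦ ⟨y, hy, rfl⟩
    · intro x
      obtain ⟨y, rfl⟩ := Submodule.mkQ_surjective _ x
      change q (g i ^ p • y - s (r y)) = g i ^ p • q y
      have : q (s (r y)) = 0 := (Submodule.Quotient.mk_eq_zero _).2 ⟨_, rfl⟩
      rw [map_sub, map_smul, this, sub_zero]
  have hQinj : ∀ x : (σ → K) ⧸ LinearMap.range s, f • x = 0 → x = 0 := by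
    intro x hx
    obtain ⟨y, rfl⟩ := Submodule.mkQ_surjective _ x
    rw [← map_smul] at hx
    -- If `f • y = s z`, write `z = f • w`; then `y = s w` because `f` is regular on `K`.
    obtain ⟨z, hz⟩ := (Submodule.Quotient.mk_eq_zero _).1 hx
    obtain ⟨w, rfl⟩ := hV' z
    refine (Submodule.Quotient.mk_eq_zero _).2 ⟨w, ?_⟩
    rw [← sub_eq_zero]
    funext k
    refine hK _ ?_
    have := congrFun hz k
    simp only [map_smul, Pi.smul_apply] at this
    simp [smul_sub, this]
  have hQfg := fg_sections hO hQ i₀ hQinj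
  -- A single power of `f` kills the cokernel of the map from `O.power σ` to the sections of `Q`.
  -- The other factor `f ^ N` will trivialize the cocycle in each coordinate.
  obtain ⟨n, hn⟩ := exists_pow_smul_mem (a := f) (N := Q) hQfg
    (fun x hx ↦ Submodule.mem_sections.1 hx i₀)
  refine ⟨n + N, fun c hc hcoc ↦ ?_⟩
  have hcO : ∀ k, ∃ d : ι → K, (∀ i, d i ∈ O.awaySaturation (g i)) ∧
      ∀ i j, f ^ N • s (c i j) k = d i - d j := by
    intro k
    refine hN (fun i j ↦ s (c i j) k) (fun i j ↦ ?_) fun i j l ↦ ?_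
    · exact Submodule.mem_awaySaturation_power.1
        (Submodule.map_mem_awaySaturation (N := O.power σ) s hs (hc i j)) k
    · rw [← hcoc i j l, map_add, Pi.add_apply]
  choose d hd hdc using hcO
  let e : ι → σ → K := fun i k ↦ d k i
  have he : ∀ i, e i ∈ (O.power σ).awaySaturation (g i) := fun i ↦
    Submodule.mem_awaySaturation_power.2 fun k ↦ hd k i
  have hec : ∀ i j, f ^ N • s (c i j) = e i - e j := fun i j ↦ funext fun k ↦ hdc k i j
  -- The differences `e i - e j` lie in the range of `s`, so the `e i` define one global section of
  -- `Q`. It is the obstruction to choosing the `e i` in the range of `s`.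
  have hqe : ∀ i j, q (e i) = q (e j) := by
    intro i j
    rw [← sub_eq_zero, ← map_sub, ← hec, ← map_smul]
    exact (Submodule.Quotient.mk_eq_zero _).2 ⟨_, rfl⟩
  have hsec : q (e i₀) ∈ Q.sections g := by
    rw [Submodule.mem_sections]
    intro i
    rw [hqe i₀ i]
    exact Submodule.map_mem_awaySaturation (N := Q) q (fun y hy ↦ ⟨y, hy, rfl⟩) (he i)
  obtain ⟨t, ht, hqt⟩ := hn _ hsec
  have hx : ∀ i, ∃ x : V, s x = f ^ n • e i - t := by
    intro i
    refine LinearMap.mem_range.1 ((Submodule.Quotient.mk_eq_zero _).1 ?_)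
    change q (f ^ n • e i - t) = 0
    rw [map_sub, hqt, map_smul, hqe i i₀, sub_self]
  choose x hx using hx
  refine ⟨x, fun i ↦ ?_, fun i j ↦ hsinj ?_⟩
  · obtain ⟨p, r, hrm, hrs⟩ := hr i
    refine Submodule.mem_awaySaturation_of_smul (n := p) ?_
    rw [← hrs, hx]
    refine Submodule.map_mem_awaySaturation r hrm (Submodule.sub_mem _
      (Submodule.smul_mem _ _ (he i)) (Submodule.le_awaySaturation _ _ ht))
  · rw [map_sub, hx, hx, map_smul, pow_add, mul_smul, hec, smul_sub]
    abel

end Lattice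


/-! ### From derived-functor cohomology to Čech cocycles -/

noncomputable section

section CechToDerived

variable {X : TopCat.{u}}

/-- Restriction of sections of a sheaf of abelian groups. -/
def Sheaf.res (F : Sheaf (Opens.grothendieckTopology X) AddCommGrpCat.{u}) {V W : Opens X}
    (h : V ≤ W) : F.obj.obj (op W) →+ F.obj.obj (op V) :=
  (F.obj.map (homOfLE h).op).hom

lemma Sheaf.res_res (F : Sheaf (Opens.grothendieckTopology X) AddCommGrpCat.{u})
    {U V W : Opens X} (h : V ≤ W) (h' : U ≤ V) (s : F.obj.obj (op W)) :
    Sheaf.res F h' (Sheaf.res F h s) = Sheaf.res F (h'.trans h) s := by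
  simp only [Sheaf.res]
  rw [← ConcreteCategory.comp_apply, ← Functor.map_comp]
  rfl

lemma Sheaf.res_self (F : Sheaf (Opens.grothendieckTopology X) AddCommGrpCat.{u})
    {W : Opens X} (s : F.obj.obj (op W)) : Sheaf.res F le_rfl s = s := by
  have : F.obj.map (homOfLE (le_refl W)).op = 𝟙 _ := F.obj.map_id _
  simp only [Sheaf.res]
  rw [this]
  rfl

lemma Sheaf.app_res {F G : Sheaf (Opens.grothendieckTopology X) AddCommGrpCat.{u}} (φ : F ⟶ G)
    {V W : Opens X} (h : V ≤ W) (s : F.obj.obj (op W)) :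
    φ.hom.app (op V) (Sheaf.res F h s) = Sheaf.res G h (φ.hom.app (op W) s) :=
  NatTrans.naturality_apply φ.hom (homOfLE h).op s

lemma Sheaf.eq_of_res_eq (F : Sheaf (Opens.grothendieckTopology X) AddCommGrpCat.{u})
    {ι : Type} (U : ι → Opens X) {V : Opens X} (hU : ∀ i, U i ≤ V) (hV : V ≤ iSup U)
    {s t : F.obj.obj (op V)} (h : ∀ i, Sheaf.res F (hU i) s = Sheaf.res F (hU i) t) : s = t :=
  TopCat.Sheaf.eq_of_locally_eq' F U V (fun i ↦ homOfLE (hU i)) hV s t h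

lemma Sheaf.exists_glue (F : Sheaf (Opens.grothendieckTopology X) AddCommGrpCat.{u})
    {ι : Type*} (U : ι → Opens X) {V : Opens X} (hU : ∀ i, U i ≤ V) (hV : V ≤ iSup U)
    (s : ∀ i, F.obj.obj (op (U i)))
    (h : ∀ i j, Sheaf.res F (inf_le_left : U i ⊓ U j ≤ _) (s i) =
      Sheaf.res F (inf_le_right : U i ⊓ U j ≤ _) (s j)) :
    ∃! t : F.obj.obj (op V), ∀ i, Sheaf.res F (hU i) t = s i :=
  TopCat.Sheaf.existsUnique_gluing' F U V (fun i ↦ homOfLE (hU i)) hV s h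

variable {ι : Type} (U : ι → Opens X)

/-- The presheaf `V ↦ ∏ k, F (V ∩ U k)`. -/
def cechPresheaf (F : Sheaf (Opens.grothendieckTopology X) AddCommGrpCat.{u}) :
    (Opens X)ᵒᵖ ⥤ AddCommGrpCat.{u} where
  obj V := AddCommGrpCat.of (∀ k, F.obj.obj (op (V.unop ⊓ U k)))
  map {V W} i := AddCommGrpCat.ofHom
    (AddMonoidHom.pi fun k ↦ (Sheaf.res F (inf_le_inf_right _ i.unop.le)).comp
      (Pi.evalAddMonoidHom _ k))
  map_id V := by
    ext s k
    exact Sheaf.res_self F _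
  map_comp i j := by
    ext s k
    exact (Sheaf.res_res F _ _ _).symm

/-- The sheaf `V ↦ ∏ k, F (V ∩ U k)`. -/
def cechSheaf (F : Sheaf (Opens.grothendieckTopology X) AddCommGrpCat.{u}) :
    Sheaf (Opens.grothendieckTopology X) AddCommGrpCat.{u} where
  obj := cechPresheaf U F
  property := by
    refine (TopCat.Presheaf.isSheaf_iff_isSheafUniqueGluing (X := X) (cechPresheaf U F)).2 ?_
    intro κ W sf hsf
    have key : ∀ k, ∃! t : F.obj.obj (op (iSup W ⊓ U k)), ∀ a,
        Sheaf.res F (inf_le_inf_right _ (le_iSup W a) : W a ⊓ U k ≤ _) t =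
          (show ∀ k, F.obj.obj (op (W a ⊓ U k)) from sf a) k := by
      intro k
      refine Sheaf.exists_glue F (fun a ↦ W a ⊓ U k) _ ?_ _ fun a b ↦ ?_
      · rw [iSup_inf_eq]
      · have h1 := congrFun (hsf a b) k
        have h2 := congrArg (Sheaf.res F (show (W a ⊓ U k) ⊓ (W b ⊓ U k) ≤ (W a ⊓ W b) ⊓ U k from
          le_inf (inf_le_inf inf_le_left inf_le_left) (inf_le_left.trans inf_le_right))) h1
        exact (Sheaf.res_res F _ _ _).symm.trans (h2.trans (Sheaf.res_res F _ _ _))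
    choose t ht ht' using key
    refine ⟨t, fun a ↦ funext fun k ↦ ht k a, fun t' h ↦ funext fun k ↦ ht' k _ fun a ↦ ?_⟩
    exact congrFun (h a) k

/-- The functoriality of `cechSheaf`. -/
def cechSheafMap {F G : Sheaf (Opens.grothendieckTopology X) AddCommGrpCat.{u}} (φ : F ⟶ G) :
    cechSheaf U F ⟶ cechSheaf U G where
  hom :=
    { app := fun V ↦ AddCommGrpCat.ofHom
        (AddMonoidHom.pi fun k ↦ (φ.hom.app (op (V.unop ⊓ U k))).hom.comp
          (Pi.evalAddMonoidHom _ k))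
      naturality := fun V W i ↦ by
        ext s
        funext k
        exact Sheaf.app_res φ _ _ }

/-- The map `F ⟶ cechSheaf U F` given by restriction. -/
def toCechSheaf (F : Sheaf (Opens.grothendieckTopology X) AddCommGrpCat.{u}) :
    F ⟶ cechSheaf U F where
  hom :=
    { app := fun V ↦ AddCommGrpCat.ofHom (AddMonoidHom.pi fun k ↦ Sheaf.res F inf_le_left)
      naturality := fun V W i ↦ by
        ext s
        funext k
        exact (Sheaf.res_res F _ _ _).trans (Sheaf.res_res F _ _ _).symm }

lemma toCechSheaf_naturality {F G : Sheaf (Opens.grothendieckTopology X) AddCommGrpCat.{u}}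
    (φ : F ⟶ G) : φ ≫ toCechSheaf U G = toCechSheaf U F ≫ cechSheafMap U φ := by
  ext V s
  funext k
  exact (Sheaf.app_res φ _ _).symm

variable {U}

lemma toCechSheaf_injective (hU : iSup U = ⊤)
    (F : Sheaf (Opens.grothendieckTopology X) AddCommGrpCat.{u}) (V : (Opens X)ᵒᵖ) :
    Function.Injective ((toCechSheaf U F).hom.app V) := by
  intro s t h
  refine Sheaf.eq_of_res_eq F (fun k ↦ V.unop ⊓ U k) (fun k ↦ inf_le_left) ?_ fun k ↦ congrFun h k
  rw [← inf_iSup_eq, hU, inf_top_eq]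

lemma mono_toCechSheaf (hU : iSup U = ⊤)
    (F : Sheaf (Opens.grothendieckTopology X) AddCommGrpCat.{u}) : Mono (toCechSheaf U F) := by
  have : Mono ((sheafToPresheaf _ _).map (toCechSheaf U F)) := by
    refine @NatTrans.mono_of_mono_app _ _ _ _ _ _ _ fun V ↦ ?_
    exact (AddCommGrpCat.mono_iff_injective _).2 (toCechSheaf_injective hU F V)
  exact (sheafToPresheaf _ _).mono_of_mono_map this

/-- Sections over an open set are left exact. -/
lemma exists_app_f_eq {S : ShortComplex (Sheaf (Opens.grothendieckTopology X) AddCommGrpCat.{u})}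
    (hS : S.ShortExact) (V : Opens X) (t : S.X₂.obj.obj (op V)) (ht : S.g.hom.app (op V) t = 0) :
    ∃ s, S.f.hom.app (op V) s = t := by
  have := hS.mono_f
  let Φ := sheafToPresheaf (Opens.grothendieckTopology X) AddCommGrpCat.{u} ⋙
    (evaluation _ _).obj (op V)
  have h := hS.exact.map_of_mono_of_preservesKernel Φ inferInstance inferInstance
  rw [ShortComplex.ab_exact_iff] at h
  exact h t ht

/-- A Čech `1`-cocycle becomes a coboundary under every morphism of sheaves that is zero on `H¹`. -/
theorem exists_coboundary {F : Sheaf (Opens.grothendieckTopology X) AddCommGrpCat.{u}} (φ : F ⟶ F)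
    (hφ : ∀ ξ : Sheaf.H.{u} F 1, Sheaf.H.map φ 1 ξ = 0) (hU : iSup U = ⊤)
    (c : ∀ i j, F.obj.obj (op (U i ⊓ U j)))
    (hc : ∀ i j k, Sheaf.res F (show U i ⊓ U j ⊓ U k ≤ U i ⊓ U j from inf_le_left) (c i j) +
      Sheaf.res F (show U i ⊓ U j ⊓ U k ≤ U j ⊓ U k from inf_le_inf_right _ inf_le_right) (c j k) =
      Sheaf.res F (show U i ⊓ U j ⊓ U k ≤ U i ⊓ U k from inf_le_inf_right _ inf_le_left) (c i k)) :
    ∃ d : ∀ i, F.obj.obj (op (U i)), ∀ i j, φ.hom.app _ (c i j) =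
      Sheaf.res F inf_le_left (d i) - Sheaf.res F inf_le_right (d j) := by
  have := mono_toCechSheaf hU F
  let S := ShortComplex.mk (toCechSheaf U F) (cokernel.π _) (cokernel.condition _)
  have hS : S.ShortExact := .mk' (ShortComplex.exact_cokernel _) this inferInstance
  let ψ : S.X₃ ⟶ S.X₃ := cokernel.map _ _ φ (cechSheafMap U φ) (toCechSheaf_naturality U φ).symm
  have hψ : S.g ≫ ψ = cechSheafMap U φ ≫ S.g := cokernel.π_desc _ _ _
  let α : S ⟶ S := { τ₁ := φ, τ₂ := cechSheafMap U φ, τ₃ := ψ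
                     comm₁₂ := toCechSheaf_naturality U φ
                     comm₂₃ := hψ.symm }
  -- Row `i` of the cocycle is a section over `U i` of the sheaf `V ↦ ∏ k, F (V ∩ U k)`. By the
  -- cocycle identity `c` is the coboundary of these rows, so their images in the cokernel glue to a
  -- global section `q`.
  let s : ∀ i, S.X₂.obj.obj (op (U i)) := fun i k ↦ c i k
  have hs : ∀ i j, Sheaf.res S.X₂ inf_le_left (s i) - Sheaf.res S.X₂ inf_le_right (s j) =
      S.f.hom.app (op (U i ⊓ U j)) (c i j) := by
    intro i j
    funext k
    exact sub_eq_iff_eq_add.2 (hc i j k).symm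
  have hgf : ∀ (V : Opens X) (x : S.X₁.obj.obj (op V)), S.g.hom.app _ (S.f.hom.app _ x) = 0 := by
    intro V x
    have h0 := congrArg (fun (β : S.X₁ ⟶ S.X₃) ↦ β.hom.app (op V) x) S.zero
    exact h0
  obtain ⟨q, hq, -⟩ := Sheaf.exists_glue S.X₃ U (V := ⊤) (fun i ↦ le_top) hU.ge
    (fun i ↦ S.g.hom.app _ (s i)) fun i j ↦ by
      rw [← Sheaf.app_res, ← Sheaf.app_res, ← sub_eq_zero, ← map_sub, hs, hgf]
  have hT : IsTerminal (⊤ : Opens X) := isTerminalTop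
  let x : Sheaf.H.{u} S.X₃ 0 := (Sheaf.H.equiv₀ S.X₃ hT).symm q
  -- The class of the cocycle is the image of `q` under the connecting map. By naturality of that
  -- map, the image of `ψ q` is `φ` applied to this class, which vanishes; thus `ψ q` lifts to a
  -- global section `t`.
  have hx : (x.comp (Abelian.Ext.mk₀ ψ) (add_zero 0)).comp hS.extClass (zero_add 1) = 0 := by
    have h1 := hφ (x.comp hS.extClass (zero_add 1))
    rw [Sheaf.H.map_apply, Abelian.Ext.comp_assoc _ _ _ _ (add_zero 1) (by omega)] at h1
    rw [Abelian.Ext.comp_assoc _ _ _ _ (zero_add 1) (by omega)]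
    have h2 := ShortComplex.ShortExact.extClass_naturality hS hS α
    exact (congrArg (fun y ↦ x.comp y (zero_add 1)) h2).symm.trans h1
  obtain ⟨y, hy⟩ := Abelian.Ext.covariant_sequence_exact₃ _ hS _ (zero_add 1) hx
  let t : S.X₂.obj.obj (op ⊤) := Sheaf.H.equiv₀ S.X₂ hT y
  have ht : S.g.hom.app (op ⊤) t = ψ.hom.app (op ⊤) q := by
    have h1 := Sheaf.H.equiv₀_naturality hT S.g y
    have h2 := Sheaf.H.equiv₀_naturality hT ψ x
    rw [AddEquiv.apply_symm_apply] at h2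
    refine h1.trans (Eq.trans ?_ h2.symm)
    exact congrArg _ hy
  have hψ' : ∀ (V : Opens X) (z : S.X₂.obj.obj (op V)),
      ψ.hom.app (op V) (S.g.hom.app (op V) z) =
        S.g.hom.app (op V) ((cechSheafMap U φ).hom.app (op V) z) := by
    intro V z
    exact congrArg (fun (β : S.X₂ ⟶ S.X₃) ↦ β.hom.app (op V) z) hψ
  have hd : ∀ i, ∃ d, S.f.hom.app (op (U i)) d =
      (cechSheafMap U φ).hom.app (op (U i)) (s i) - Sheaf.res S.X₂ le_top t := by
    intro i
    refine exists_app_f_eq hS (U i) _ ?_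
    rw [map_sub, Sheaf.app_res, ht, ← Sheaf.app_res, hq, ← hψ', sub_self]
  choose d hd using hd
  refine ⟨d, fun i j ↦ toCechSheaf_injective hU F _ ?_⟩
  change S.f.hom.app _ _ = S.f.hom.app _ _
  rw [map_sub, Sheaf.app_res, Sheaf.app_res, hd, hd, map_sub, map_sub, Sheaf.res_res,
    Sheaf.res_res, sub_sub_sub_cancel_right, ← Sheaf.app_res, ← Sheaf.app_res, ← map_sub, hs]
  exact congrArg (fun (β : F ⟶ cechSheaf U F) ↦ β.hom.app _ (c i j)) (toCechSheaf_naturality U φ)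

end CechToDerived

end


/-! ### Lattices that are locally projective over a given lattice -/

section Lattice

variable {A : Type*} [CommRing A] {K V : Type*} [AddCommGroup K] [Module A K]
  [AddCommGroup V] [Module A V] {ι : Type}

lemma Submodule.awaySaturation_mono (a : A) {M N : Submodule A V} (h : M ≤ N) :
    M.awaySaturation a ≤ N.awaySaturation a :=
  fun _ ⟨n, hn⟩ ↦ ⟨n, h hn⟩

lemma Submodule.awaySaturation_eq_of_le {a : A} {M N : Submodule A V} (h : M ≤ N)
    (h' : N ≤ M.awaySaturation a) : M.awaySaturation a = N.awaySaturation a := by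
  refine le_antisymm (Submodule.awaySaturation_mono a h) ?_
  rintro x ⟨n, hn⟩
  exact Submodule.mem_awaySaturation_of_smul (h' hn)

lemma Submodule.awaySaturation_le_mul (a b : A) (M : Submodule A V) :
    M.awaySaturation a ≤ M.awaySaturation (a * b) := by
  rintro x ⟨n, hn⟩
  refine ⟨n, ?_⟩
  rw [mul_comm, mul_pow, mul_smul]
  exact M.smul_mem _ hn

/-- A lattice `B` that is locally a finite projective module over the finite lattice `O` contains a
finite lattice with the same localizations. -/
lemma exists_fg_isAwayRetract [Finite ι] {g : ι → A} {O : Submodule A K} (hO : O.FG)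
    {B : Submodule A V}
    (h : ∀ i, ∃ (σ : Type) (_ : Finite σ) (s : V →ₗ[A] (σ → K)) (r : (σ → K) →ₗ[A] V),
      (∀ x ∈ B, s x ∈ (O.power σ).awaySaturation (g i)) ∧
      (∀ y ∈ O.power σ, r y ∈ B.awaySaturation (g i)) ∧ ∀ x, r (s x) = x) :
    ∃ M ≤ B, (∀ i, IsAwayRetract O M (g i)) ∧ ∀ i, B ≤ M.awaySaturation (g i) := by
  choose σ hσ s r hs hr hrs using h
  have hOσ : ∀ i, (O.power (σ i)).FG := fun i ↦ Submodule.fg_pi fun _ ↦ hO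
  have h1 : ∀ i, ∃ m : ℕ, ∀ x ∈ (O.power (σ i)).map (r i), g i ^ m • x ∈ B := by
    refine fun i ↦ exists_pow_smul_mem ((hOσ i).map _) ?_
    rintro _ ⟨y, hy, rfl⟩
    exact hr i y hy
  choose m hm using h1
  -- The exponents `m i` clear the denominators of the retractions, so `M` lies in `B`; finitely
  -- many finite modules generate it, and it still contains enough to have the same localizations.
  let M : Submodule A V := ⨆ i, (O.power (σ i)).map (g i ^ m i • r i)
  have hMB : M ≤ B := by
    refine iSup_le fun i ↦ ?_
    rintro _ ⟨y, hy, rfl⟩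
    exact hm i _ ⟨y, hy, rfl⟩
  have hMr : ∀ i, ∀ y ∈ O.power (σ i), g i ^ m i • r i y ∈ M := fun i y hy ↦
    (le_iSup (fun i ↦ (O.power (σ i)).map (g i ^ m i • r i)) i) ⟨y, hy, rfl⟩
  have hM : M.FG := Submodule.fg_iSup _ fun i ↦ (hOσ i).map _
  refine ⟨M, hMB, fun i ↦ ?_, fun i x hx ↦ ?_⟩
  · obtain ⟨n, hn⟩ := exists_pow_smul_mem (a := g i) (N := O.power (σ i)) (hM.map (s i)) (by
      rintro _ ⟨y, hy, rfl⟩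
      exact hs i y (hMB hy))
    refine ⟨σ i, hσ i, m i + n, g i ^ n • s i, g i ^ m i • r i, fun x hx ↦ hn _ ⟨x, hx, rfl⟩,
      hMr i, fun x ↦ ?_⟩
    rw [LinearMap.smul_apply, LinearMap.smul_apply, map_smul, hrs, smul_smul, ← pow_add]
  · obtain ⟨k, hk⟩ := hs i x hx
    refine ⟨m i + k, ?_⟩
    have := hMr i _ hk
    rwa [map_smul, hrs, smul_smul, ← pow_add] at this

/-- Finiteness of global sections and annihilation of the first Čech cohomology pass from `O` to
lattices that are locally finite projective over `O`. -/
theorem fg_sections_and_exists_cechAnnihilated [IsNoetherianRing A] [Finite ι] {g : ι → A}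
    {O : Submodule A K} (hO : O.FG) (hO' : (O.sections g).FG) {B : Submodule A V}
    (h : ∀ i, ∃ (σ : Type) (_ : Finite σ) (s : V →ₗ[A] (σ → K)) (r : (σ → K) →ₗ[A] V),
      (∀ x ∈ B, s x ∈ (O.power σ).awaySaturation (g i)) ∧
      (∀ y ∈ O.power σ, r y ∈ B.awaySaturation (g i)) ∧ ∀ x, r (s x) = x)
    (i₀ : ι) (hK : ∀ x : K, g i₀ • x = 0 → x = 0) (hV : ∀ x : V, g i₀ • x = 0 → x = 0)
    (hV' : ∀ x : V, ∃ y, g i₀ • y = x) {N : ℕ} (hN : CechAnnihilated g O (g i₀ ^ N)) :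
    (B.sections g).FG ∧ ∃ N' : ℕ, CechAnnihilated g B (g i₀ ^ N') := by
  obtain ⟨M, hMB, hM, hBM⟩ := exists_fg_isAwayRetract hO h
  have h1 : ∀ i, M.awaySaturation (g i) = B.awaySaturation (g i) := fun i ↦
    Submodule.awaySaturation_eq_of_le hMB (hBM i)
  have h2 : ∀ i j, M.awaySaturation (g i * g j) = B.awaySaturation (g i * g j) := fun i j ↦
    Submodule.awaySaturation_eq_of_le hMB ((hBM i).trans (Submodule.awaySaturation_le_mul _ _ _))
  refine ⟨?_, ?_⟩
  · have := fg_sections hO' hM i₀ hV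
    simpa only [Submodule.sections, h1] using this
  · obtain ⟨N', hN'⟩ := exists_cechAnnihilated hO' hM i₀ hK hV hV' hN
    refine ⟨N', fun c hc hcoc ↦ ?_⟩
    simpa only [h1] using hN' c (by simpa only [h2] using hc) hcoc

end Lattice

/-! ### Lifting idempotents -/

section Idempotents

variable {R : Type*} [CommRing R]

/-- Newton's iteration for `X ^ 2 - X`, with `2 * b - 1` as its own approximate inverse, gives `3 *
b ^ 2 - 2 * b ^ 3`. The error is multiplied by itself, which more than suffices to gain one power of
`f`. -/
lemma exists_lift_idempotent_mod_pow {f a : R} (ha : f ∣ a ^ 2 - a) (n : ℕ) :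
    ∃ b, f ∣ b - a ∧ f ^ n ∣ b ^ 2 - b := by
  induction n with
  | zero => exact ⟨a, by simp, by simp⟩
  | succ n ih =>
    rcases Nat.eq_zero_or_pos n with rfl | hn
    · exact ⟨a, by simp, by simpa using ha⟩
    obtain ⟨b, ⟨x, hx⟩, y, hy⟩ := ih
    obtain ⟨m, rfl⟩ := Nat.exists_eq_add_of_lt hn
    rw [zero_add] at hy ⊢
    refine ⟨3 * b ^ 2 - 2 * b ^ 3, ⟨x - f ^ m * y * (2 * b - 1), ?_⟩,
      ⟨f ^ m * y ^ 2 * (4 * b ^ 2 - 4 * b - 3), ?_⟩⟩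
    · have : 3 * b ^ 2 - 2 * b ^ 3 - a = (b - a) - (b ^ 2 - b) * (2 * b - 1) := by ring
      rw [this, hx, hy]
      ring
    · have : (3 * b ^ 2 - 2 * b ^ 3) ^ 2 - (3 * b ^ 2 - 2 * b ^ 3) =
          (b ^ 2 - b) ^ 2 * (4 * b ^ 2 - 4 * b - 3) := by ring
      rw [this, hy]
      ring

/-- The difference of two commuting idempotents equals its own cube. Modulo `f ^ n` this improves
divisibility by `f ^ k` to divisibility by `f ^ (3 * k)`, as long as the exponent stays below `n`.
-/
lemma dvd_sub_of_idempotent_mod_pow {f b b' : R} {n : ℕ} (hb : f ^ n ∣ b ^ 2 - b)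
    (hb' : f ^ n ∣ b' ^ 2 - b') (h : f ∣ b - b') : f ^ n ∣ b - b' := by
  obtain ⟨x, hx⟩ := hb
  obtain ⟨y, hy⟩ := hb'
  have key : (b - b') = (b - b') ^ 3 - f ^ n * (x * (b + 1 - 3 * b') - y * (b' + 1 - 3 * b)) := by
    linear_combination (-(b + 1 - 3 * b')) * hx + (b' + 1 - 3 * b) * hy
  have : ∀ k, 1 ≤ k → k ≤ n → f ^ k ∣ b - b' := by
    intro k hk
    induction k, hk using Nat.le_induction with
    | base => simpa using fun _ ↦ h
    | succ k hk ih =>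
      intro hkn
      rw [key]
      refine dvd_sub ?_ ((pow_dvd_pow f hkn).mul_right _)
      refine (pow_dvd_pow f (by omega : k + 1 ≤ k * 3)).trans ?_
      rw [pow_mul]
      exact pow_dvd_pow_of_dvd (ih (by omega)) 3
  rcases Nat.eq_zero_or_pos n with rfl | hn
  · simp
  · exact this n hn le_rfl

/-- Idempotents lift along Henselian pairs. -/
lemma HenselianRing.exists_isIdempotentElem {I : Ideal R} [HenselianRing R I] {a : R}
    (ha : a ^ 2 - a ∈ I) : ∃ b, b ^ 2 = b ∧ b - a ∈ I := by
  open Polynomial in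
  obtain ⟨b, hb, hba⟩ := HenselianRing.is_henselian (I := I) (X ^ 2 - X : R[X])
    (by
      rcases subsingleton_or_nontrivial R with h | h
      · exact Subsingleton.elim _ _
      · monicity!) a (by simpa using ha) (by
      simp only [derivative_sub, derivative_X_pow, derivative_X, eval_sub]
      -- The derivative `2 * a - 1` is its own inverse modulo `I`, since `(2 * a - 1) ^ 2 = 1 + 4 *
      -- (a ^ 2 - a)`.
      refine IsUnit.of_mul_eq_one (Ideal.Quotient.mk I (2 * a - 1)) ?_
      rw [← map_mul, ← map_one (Ideal.Quotient.mk I), Ideal.Quotient.eq]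
      have : (2 * a - 1) * (2 * a - 1) - 1 = 4 * (a ^ 2 - a) := by ring
      simpa [this] using I.mul_mem_left 4 ha)
  refine ⟨b, ?_, hba⟩
  simpa [Polynomial.IsRoot, sub_eq_zero] using hb

/-- A finite module over a complete noetherian ring is complete. -/
theorem isAdicComplete_of_finite [IsNoetherianRing R] (I : Ideal R) [IsAdicComplete I R]
    (M : Type*) [AddCommGroup M] [Module R M] [Module.Finite R M] : IsAdicComplete I M := by
  have : IsHausdorff I M := .of_le_jacobson _ _ (IsAdicComplete.le_jacobson_bot I)
  have : IsPrecomplete I M := by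
    -- The completion of the finite module `M` is a quotient of `M` tensored with the completion of
    -- `R`, and the elements of that completion already come from `R`.
    rw [← AdicCompletion.of_surjective_iff]
    intro y
    obtain ⟨x, rfl⟩ := AdicCompletion.ofTensorProduct_surjective_of_finite I M y
    induction x using TensorProduct.induction_on with
    | zero => exact ⟨0, by simp⟩
    | tmul r m =>
      obtain ⟨r, rfl⟩ := AdicCompletion.of_surjective I R r
      exact ⟨r • m, by
        rw [AdicCompletion.ofTensorProduct_tmul, map_smul]
        rfl⟩
    | add x y hx hy =>
      obtain ⟨a, ha⟩ := hx
      obtain ⟨b, hb⟩ := hy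
      exact ⟨a + b, by rw [map_add, map_add, ha, hb]⟩
  exact {}

/-- Idempotents lift modulo `f` in finite algebras over an `f`-adically complete noetherian ring. -/
lemma exists_isIdempotentElem_of_finite [IsNoetherianRing R] {f : R}
    [IsAdicComplete (Ideal.span {f}) R] {B : Type*} [CommRing B] [Algebra R B] [Module.Finite R B]
    {a : B} (ha : algebraMap R B f ∣ a ^ 2 - a) :
    ∃ b, b ^ 2 = b ∧ algebraMap R B f ∣ b - a := by
  have := isAdicComplete_of_finite (Ideal.span {f}) B
  have h2 : IsAdicComplete ((Ideal.span {f}).map (algebraMap R B)) B :=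
    (IsAdicComplete.map_algebraMap_iff _ _).2 this
  rw [Ideal.map_span, Set.image_singleton] at h2
  simp only [← Ideal.mem_span_singleton] at ha ⊢
  exact HenselianRing.exists_isIdempotentElem ha

end Idempotents


/-! ### Sections over basic opens as localizations of a lattice -/

noncomputable section

section Sections

variable {A : Type u} [CommRing A] {X : Scheme.{u}} (θ : A →+* Γ(X, ⊤))

/-- The sections of the structure sheaf over `U`, as an algebra over a ring that maps to the global
functions. -/
def Sec (_ : A →+* Γ(X, ⊤)) (U : X.Opens) : Type u := Γ(X, U)

instance (U : X.Opens) : CommRing (Sec θ U) := inferInstanceAs (CommRing Γ(X, U))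

instance (U : X.Opens) : Algebra A (Sec θ U) :=
  ((X.presheaf.map (homOfLE (le_top : U ≤ ⊤)).op).hom.comp θ).toAlgebra

/-- Restriction of sections. -/
def Sec.res {U V : X.Opens} (h : V ≤ U) : Sec θ U →ₐ[A] Sec θ V where
  __ := (X.presheaf.map (homOfLE h).op).hom
  commutes' a := by
    change X.presheaf.map (homOfLE h).op (X.presheaf.map (homOfLE (le_top : U ≤ ⊤)).op (θ a)) =
      X.presheaf.map (homOfLE (le_top : V ≤ ⊤)).op (θ a)
    rw [← CommRingCat.comp_apply, ← Functor.map_comp]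
    rfl

variable {θ}

lemma Sec.res_res {U V W : X.Opens} (h : V ≤ U) (h' : W ≤ V) (s : Sec θ U) :
    Sec.res θ h' (Sec.res θ h s) = Sec.res θ (h'.trans h) s := by
  let t : Γ(X, U) := s
  change X.presheaf.map (homOfLE h').op (X.presheaf.map (homOfLE h).op t) =
    X.presheaf.map (homOfLE (h'.trans h)).op t
  rw [← CommRingCat.comp_apply, ← Functor.map_comp]
  rfl

lemma Sec.res_self {U : X.Opens} (s : Sec θ U) : Sec.res θ le_rfl s = s := by
  change X.presheaf.map (𝟙 (op U)) s = s
  rw [X.presheaf.map_id]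
  rfl

lemma Sec.eq_of_res_eq {ι : Type*} (U : ι → X.Opens) {V : X.Opens} (hU : ∀ i, U i ≤ V)
    (hV : V ≤ iSup U) {s t : Sec θ V} (h : ∀ i, Sec.res θ (hU i) s = Sec.res θ (hU i) t) : s = t :=
  TopCat.Sheaf.eq_of_locally_eq' X.sheaf U V (fun i ↦ homOfLE (hU i)) hV s t h

lemma Sec.exists_glue {ι : Type*} (U : ι → X.Opens) {V : X.Opens} (hU : ∀ i, U i ≤ V)
    (hV : V ≤ iSup U) (s : ∀ i, Sec θ (U i))
    (h : ∀ i j, Sec.res θ (inf_le_left : U i ⊓ U j ≤ _) (s i) =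
      Sec.res θ (inf_le_right : U i ⊓ U j ≤ _) (s j)) :
    ∃ t : Sec θ V, ∀ i, Sec.res θ (hU i) t = s i :=
  (TopCat.Sheaf.existsUnique_gluing' X.sheaf U V (fun i ↦ homOfLE (hU i)) hV s
    fun i j ↦ h i j).exists

lemma Sec.isUnit_algebraMap {a : A} {U : X.Opens} (hU : U ≤ X.basicOpen (θ a)) :
    IsUnit (algebraMap A (Sec θ U) a) := by
  have h := RingedSpace.isUnit_res_basicOpen (X := X.toLocallyRingedSpace.toRingedSpace) (θ a)
  have h2 : IsUnit (algebraMap A (Sec θ (X.basicOpen (θ a))) a) := h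
  have h3 := h2.map (Sec.res θ hU)
  rwa [AlgHom.commutes] at h3

lemma Sec.smul_injective {a : A} {U : X.Opens} (hU : U ≤ X.basicOpen (θ a)) (n : ℕ)
    {x y : Sec θ U} (h : a ^ n • x = a ^ n • y) : x = y := by
  rw [Algebra.smul_def, Algebra.smul_def, map_pow] at h
  exact ((Sec.isUnit_algebraMap hU).pow n).mul_left_cancel h

lemma Sec.exists_smul_eq {a : A} {U : X.Opens} (hU : U ≤ X.basicOpen (θ a)) (n : ℕ)
    (x : Sec θ U) : ∃ y, a ^ n • y = x := by
  obtain ⟨u, hu⟩ := (Sec.isUnit_algebraMap hU).pow n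
  refine ⟨↑u⁻¹ * x, ?_⟩
  rw [Algebra.smul_def, map_pow, ← hu, Units.mul_inv_cancel_left]

variable [CompactSpace X] [QuasiSeparatedSpace X]

lemma Sec.exists_pow_smul_eq_res {a : A} {U : X.Opens} (hU : U = X.basicOpen (θ a))
    (y : Sec θ U) : ∃ (n : ℕ) (b : Sec θ (⊤ : X.Opens)), Sec.res θ le_top b = a ^ n • y := by
  subst hU
  have := isLocalization_basicOpen_of_qcqs (X := X) (U := ⊤) isCompact_univ
    isQuasiSeparated_univ (θ a)
  obtain ⟨n, b, hb⟩ := IsLocalization.Away.surj (θ a) (S := Γ(X, X.basicOpen (θ a))) y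
  refine ⟨n, b, ?_⟩
  rw [Algebra.smul_def, map_pow, mul_comm]
  exact hb.symm

omit [QuasiSeparatedSpace X] in
lemma Sec.exists_pow_smul_eq_zero {a : A} {U : X.Opens} (hU : U = X.basicOpen (θ a))
    {b : Sec θ (⊤ : X.Opens)} (hb : Sec.res θ (le_top : U ≤ ⊤) b = 0) :
    ∃ n : ℕ, a ^ n • b = 0 := by
  subst hU
  obtain ⟨n, hn⟩ := exists_pow_mul_eq_zero_of_res_basicOpen_eq_zero_of_isCompact X
    (U := ⊤) isCompact_univ b (θ a) hb
  refine ⟨n, ?_⟩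
  rw [Algebra.smul_def, map_pow]
  have h1 : algebraMap A (Sec θ (⊤ : X.Opens)) a = θ a := Sec.res_self (θ := θ) (θ a)
  rw [h1]
  exact hn

variable {h : A} (hreg : ∀ b : Sec θ (⊤ : X.Opens), h • b = 0 → b = 0)

include hreg in
-- After multiplication by a power of `a`, a section over `D(a)` extends globally. If it vanishes on
-- `D(h)`, the extension is killed by a power of `h`, hence is zero.
lemma Sec.res_injective {a : A} {U W : X.Opens} (hU : U = X.basicOpen (θ a))
    (hW : W = X.basicOpen (θ h)) (hWU : W ≤ U) : Function.Injective (Sec.res θ hWU) := by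
  rw [injective_iff_map_eq_zero]
  intro y hy
  obtain ⟨n, b, hb⟩ := Sec.exists_pow_smul_eq_res hU y
  have hb' : Sec.res θ (le_top : W ≤ ⊤) b = 0 := by
    rw [← Sec.res_res le_top hWU, hb, map_smul, hy, smul_zero]
  obtain ⟨m, hm⟩ := Sec.exists_pow_smul_eq_zero hW hb'
  have hb0 : b = 0 := eq_zero_of_pow_smul hreg m hm
  refine Sec.smul_injective hU.le n ?_
  rw [← hb, hb0, map_zero, smul_zero]

variable (θ) in
/-- The lattice of global sections in the sections over `W`. -/
def Sec.lattice (W : X.Opens) : Submodule A (Sec θ W) :=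
  LinearMap.range (Sec.res θ (le_top : W ≤ ⊤)).toLinearMap

/-- The localizations of the lattice of global sections are the sections over basic opens. -/
lemma Sec.mem_awaySaturation_lattice {a : A} {U W : X.Opens} (hU : U = X.basicOpen (θ a))
    (hWU : W ≤ U) {x : Sec θ W} :
    x ∈ (Sec.lattice θ W).awaySaturation a ↔ ∃ y, Sec.res θ hWU y = x := by
  constructor
  · rintro ⟨n, b, hb⟩
    obtain ⟨y, hy⟩ := Sec.exists_smul_eq hU.le n (Sec.res θ (le_top : U ≤ ⊤) b)
    refine ⟨y, Sec.smul_injective (hWU.trans hU.le) n ?_⟩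
    rw [← map_smul, hy, Sec.res_res]
    exact hb
  · rintro ⟨y, rfl⟩
    obtain ⟨n, b, hb⟩ := Sec.exists_pow_smul_eq_res hU y
    refine ⟨n, b, ?_⟩
    change Sec.res θ le_top b = _
    rw [← Sec.res_res le_top hWU, hb, map_smul]

variable {ι : Type} {g : ι → A} {U : ι → X.Opens} {W : X.Opens}

include hreg in
-- This is the sheaf axiom: local sections with the same restriction to `W` agree on overlaps,
-- because restriction from an overlap to `W` is injective.
lemma Sec.sections_lattice [Nonempty ι] (hU : ∀ i, U i = X.basicOpen (θ (g i))) (hcov : ⨆ i, U i = ⊤)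
    (hW : W = X.basicOpen (θ h)) (hWU : ∀ i, W ≤ U i) :
    (Sec.lattice θ W).sections g = Sec.lattice θ W := by
  refine le_antisymm (fun x hx ↦ ?_) (fun x hx ↦ ?_)
  · rw [Submodule.mem_sections] at hx
    have hx' := fun i ↦ (Sec.mem_awaySaturation_lattice (hU i) (hWU i)).1 (hx i)
    choose y hy using hx'
    obtain ⟨t, ht⟩ := Sec.exists_glue U (V := ⊤) (fun i ↦ le_top) hcov.ge y fun i j ↦ by
      refine Sec.res_injective hreg (a := g i * g j) ?_ hW (le_inf (hWU i) (hWU j)) ?_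
      · rw [map_mul, Scheme.basicOpen_mul, hU, hU]
      · rw [Sec.res_res, Sec.res_res, hy, hy]
    obtain ⟨i⟩ := ‹Nonempty ι›
    refine ⟨t, ?_⟩
    change Sec.res θ le_top t = x
    rw [← Sec.res_res le_top (hWU i), ht, hy]
  · rw [Submodule.mem_sections]
    exact fun i ↦ Submodule.le_awaySaturation _ _ hx

include hreg in
-- This allows linear maps between sections over `U` to be extended to the ambient modules of
-- sections over `W`.
lemma Sec.isLocalizedModule_res {a : A} {U W : X.Opens} (hU : U = X.basicOpen (θ a))
    (hW : W = X.basicOpen (θ h)) (hWU : W ≤ U) :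
    IsLocalizedModule (Submonoid.powers h) (Sec.res θ hWU).toLinearMap where
  map_units := by
    rintro ⟨_, n, rfl⟩
    rw [Module.End.isUnit_iff]
    refine ⟨fun x y hxy ↦ Sec.smul_injective hW.le n hxy, fun x ↦ Sec.exists_smul_eq hW.le n x⟩
  surj x := by
    obtain ⟨n, b, hb⟩ := Sec.exists_pow_smul_eq_res hW x
    refine ⟨⟨Sec.res θ le_top b, ⟨h ^ n, n, rfl⟩⟩, ?_⟩
    change h ^ n • x = Sec.res θ hWU (Sec.res θ le_top b)
    rw [Sec.res_res, hb]
  exists_of_eq {x y} hxy := ⟨1, by rw [Sec.res_injective hreg hU hW hWU hxy]⟩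

end Sections

end


/-! ### Finite flat covers: transfer of the cohomological hypotheses -/

noncomputable section

section FiniteFlat

variable {A : Type u} [CommRing A] {V W : Scheme.{u}} (θ : A →+* Γ(V, ⊤)) (p : W ⟶ V)

/-- The map to global functions on `W` induced by a morphism `W ⟶ V`. -/
abbrev pullHom : A →+* Γ(W, ⊤) := p.appTop.hom.comp θ

lemma preimage_basicOpen_eq (a : A) :
    p ⁻¹ᵁ V.basicOpen (θ a) = W.basicOpen (pullHom θ p a) :=
  Scheme.preimage_basicOpen_top p (θ a)

/-- Pullback of sections. -/
def Sec.pull (U : V.Opens) : Sec θ U →ₐ[A] Sec (pullHom θ p) (p ⁻¹ᵁ U) where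
  __ := (p.app U).hom
  commutes' a := by
    change p.app U (V.presheaf.map (homOfLE (le_top : U ≤ ⊤)).op (θ a)) =
      W.presheaf.map (homOfLE (le_top : p ⁻¹ᵁ U ≤ ⊤)).op (p.appTop (θ a))
    exact ConcreteCategory.congr_hom (p.naturality (homOfLE (le_top : U ≤ ⊤)).op) (θ a)

variable {θ p} in
lemma Sec.pull_res {U U' : V.Opens} (h : U' ≤ U) (s : Sec θ U) :
    Sec.pull θ p U' (Sec.res θ h s) =
      Sec.res (pullHom θ p) (show p ⁻¹ᵁ U' ≤ p ⁻¹ᵁ U from p.preimage_mono h)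
        (Sec.pull θ p U s) :=
  ConcreteCategory.congr_hom (p.naturality (homOfLE h).op) (show Γ(V, U) from s)

/-- Sections of a finite flat scheme over an affine open subset are a direct summand of a finite
free module. -/
lemma exists_linear_retract [IsFinite p] [Flat p] {U : V.Opens} (hU : IsAffineOpen U)
    [hN : IsNoetherianRing Γ(V, U)] :
    ∃ (n : ℕ) (s : Sec (pullHom θ p) (p ⁻¹ᵁ U) →ₗ[A] (Fin n → Sec θ U))
      (r : (Fin n → Sec θ U) →ₗ[A] Sec (pullHom θ p) (p ⁻¹ᵁ U)), ∀ x, r (s x) = x := by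
  let _ : Algebra (Sec θ U) (Sec (pullHom θ p) (p ⁻¹ᵁ U)) := (Sec.pull θ p U).toRingHom.toAlgebra
  have : IsScalarTower A (Sec θ U) (Sec (pullHom θ p) (p ⁻¹ᵁ U)) :=
    .of_algebraMap_eq fun a ↦ ((Sec.pull θ p U).commutes a).symm
  have : IsNoetherianRing (Sec θ U) := hN
  have hfin : Module.Finite (Sec θ U) (Sec (pullHom θ p) (p ⁻¹ᵁ U)) := p.finite_app U hU
  have hflat : Module.Flat (Sec θ U) (Sec (pullHom θ p) (p ⁻¹ᵁ U)) := by
    have h1 := p.flat_appLE hU (hU.preimage p) le_rfl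
    rw [← Scheme.Hom.app_eq_appLE] at h1
    exact h1
  have : Module.FinitePresentation (Sec θ U) (Sec (pullHom θ p) (p ⁻¹ᵁ U)) :=
    Module.finitePresentation_of_finite _ _
  have : Module.Projective (Sec θ U) (Sec (pullHom θ p) (p ⁻¹ᵁ U)) :=
    Module.Flat.projective_of_finitePresentation
  obtain ⟨n, r, s, -, -, hrs⟩ := Module.Finite.exists_comp_eq_id_of_projective (Sec θ U)
    (Sec (pullHom θ p) (p ⁻¹ᵁ U))
  exact ⟨n, s.restrictScalars A, r.restrictScalars A, fun x ↦ DFunLike.congr_fun hrs x⟩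

/-- A finite cover of `V` by affine noetherian basic opens all of which contain the basic open of an
element acting regularly. -/
structure IsLatticeCover {ι : Type} (g : ι → A) (h : A) : Prop where
  isAffineOpen : ∀ i, IsAffineOpen (V.basicOpen (θ (g i)))
  isNoetherianRing : ∀ i, IsNoetherianRing Γ(V, V.basicOpen (θ (g i)))
  iSup_eq : ⨆ i, V.basicOpen (θ (g i)) = ⊤
  le : ∀ i, V.basicOpen (θ h) ≤ V.basicOpen (θ (g i))
  regular : ∀ i, ∀ b : Sec θ (V.basicOpen (θ (g i))), h • b = 0 → b = 0

variable {θ p} {ι : Type} {g : ι → A} {h : A}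

lemma IsLatticeCover.iSup_preimage_eq (H : IsLatticeCover θ g h) :
    ⨆ i, p ⁻¹ᵁ V.basicOpen (θ (g i)) = ⊤ := by
  rw [← Scheme.Hom.preimage_iSup, H.iSup_eq, Scheme.Hom.preimage_top]

/-- Regularity of `h` is local on the cover, and over each affine member the sections on `W` embed
linearly into a power of those on `V`. -/
lemma IsLatticeCover.smul_eq_zero_of_pullHom [IsFinite p] [Flat p] (H : IsLatticeCover θ g h)
    (b : Sec (pullHom θ p) (⊤ : W.Opens)) (hb : h • b = 0) : b = 0 := by
  refine Sec.eq_of_res_eq (fun i ↦ p ⁻¹ᵁ V.basicOpen (θ (g i))) (fun i ↦ le_top)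
    H.iSup_preimage_eq.ge fun i ↦ ?_
  have := H.isNoetherianRing i
  obtain ⟨n, s, r, hrs⟩ := exists_linear_retract θ p (H.isAffineOpen i)
  rw [map_zero, ← hrs (Sec.res _ _ b)]
  convert map_zero r
  funext k
  refine H.regular i _ ?_
  rw [← Pi.smul_apply, ← map_smul, ← map_smul, hb, map_zero, map_zero]
  rfl

lemma IsLatticeCover.smul_eq_zero (H : IsLatticeCover θ g h)
    (b : Sec θ (⊤ : V.Opens)) (hb : h • b = 0) : b = 0 := by
  refine Sec.eq_of_res_eq (fun i ↦ V.basicOpen (θ (g i))) (fun i ↦ le_top) H.iSup_eq.ge fun i ↦ ?_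
  rw [map_zero]
  refine H.regular i _ ?_
  rw [← map_smul, hb, map_zero]

variable [CompactSpace V] [QuasiSeparatedSpace V] [CompactSpace W] [QuasiSeparatedSpace W]

/-- The sections of a finite flat scheme form locally a finite projective lattice. -/
lemma IsLatticeCover.exists_retract [IsFinite p] [Flat p] (H : IsLatticeCover θ g h) (i : ι) :
    ∃ (σ : Type) (_ : Finite σ)
      (s : Sec (pullHom θ p) (p ⁻¹ᵁ V.basicOpen (θ h)) →ₗ[A] (σ → Sec θ (V.basicOpen (θ h))))
      (r : (σ → Sec θ (V.basicOpen (θ h))) →ₗ[A] Sec (pullHom θ p) (p ⁻¹ᵁ V.basicOpen (θ h))),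
      (∀ x ∈ Sec.lattice (pullHom θ p) (p ⁻¹ᵁ V.basicOpen (θ h)),
        s x ∈ ((Sec.lattice θ (V.basicOpen (θ h))).power σ).awaySaturation (g i)) ∧
      (∀ y ∈ (Sec.lattice θ (V.basicOpen (θ h))).power σ,
        r y ∈ (Sec.lattice (pullHom θ p) (p ⁻¹ᵁ V.basicOpen (θ h))).awaySaturation (g i)) ∧
      ∀ x, r (s x) = x := by
  have := H.isNoetherianRing i
  obtain ⟨n, s, r, hrs⟩ := exists_linear_retract θ p (H.isAffineOpen i)
  have hle := H.le i
  have hle' : p ⁻¹ᵁ V.basicOpen (θ h) ≤ p ⁻¹ᵁ V.basicOpen (θ (g i)) := p.preimage_mono hle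
  let ρ := (Sec.res θ hle).toLinearMap
  let ρ' := (Sec.res (pullHom θ p) hle').toLinearMap
  have h1 : IsLocalizedModule (Submonoid.powers h) ρ :=
    Sec.isLocalizedModule_res H.smul_eq_zero rfl rfl hle
  have h2 : IsLocalizedModule (Submonoid.powers h) ρ' :=
    Sec.isLocalizedModule_res H.smul_eq_zero_of_pullHom (preimage_basicOpen_eq _ _ _)
      (preimage_basicOpen_eq _ _ _) hle'
  let ρn : (Fin n → Sec θ (V.basicOpen (θ (g i)))) →ₗ[A] (Fin n → Sec θ (V.basicOpen (θ h))) :=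
    .pi fun k ↦ ρ ∘ₗ .proj k
  have h3 : IsLocalizedModule (Submonoid.powers h) ρn := IsLocalizedModule.pi _ fun _ ↦ ρ
  let s' := IsLocalizedModule.map (Submonoid.powers h) ρ' ρn s
  let r' := IsLocalizedModule.map (Submonoid.powers h) ρn ρ' r
  have hs' : ∀ x, s' (ρ' x) = ρn (s x) := IsLocalizedModule.map_apply _ _ _ _
  have hr' : ∀ x, r' (ρn x) = ρ' (r x) := IsLocalizedModule.map_apply _ _ _ _
  have hrs' : r' ∘ₗ s' = .id := by
    refine IsLocalizedModule.linearMap_ext (Submonoid.powers h) ρ' ρ' ?_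
    ext x
    change r' (s' (ρ' x)) = ρ' x
    rw [hs', hr', hrs]
  refine ⟨Fin n, inferInstance, s', r', ?_, ?_, fun x ↦ DFunLike.congr_fun hrs' x⟩
  · rintro _ ⟨b, rfl⟩
    rw [Submodule.mem_awaySaturation_power]
    intro k
    refine (Sec.mem_awaySaturation_lattice rfl hle).2
      ⟨s (Sec.res (pullHom θ p) le_top b) k, ?_⟩
    have h4 := congrFun (hs' (Sec.res (pullHom θ p) le_top b)) k
    refine Eq.trans h4.symm ?_
    change s' (Sec.res (pullHom θ p) hle' (Sec.res (pullHom θ p) le_top b)) k = _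
    rw [Sec.res_res]
    rfl
  · intro y hy
    have hy' : ∀ k, ∃ z : Sec θ (⊤ : V.Opens), Sec.res θ le_top z = y k := fun k ↦ hy k trivial
    choose z hz using hy'
    refine (Sec.mem_awaySaturation_lattice (preimage_basicOpen_eq _ _ _) hle').2
      ⟨r fun k ↦ Sec.res θ le_top (z k), ?_⟩
    refine (hr' _).symm.trans (congrArg r' (funext fun k ↦ ?_))
    change Sec.res θ hle (Sec.res θ le_top (z k)) = y k
    rw [Sec.res_res, hz]

/-- Finiteness of `H⁰` and annihilation of `H¹` by a power of `f` for the structure sheaf pass to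
finite flat covers. -/
theorem IsLatticeCover.fg_lattice_and_exists_cechAnnihilated [IsNoetherianRing A] [Finite ι]
    [IsFinite p] [Flat p] (H : IsLatticeCover θ g h)
    (hO : (Sec.lattice θ (V.basicOpen (θ h))).FG) (i₀ : ι) {N : ℕ}
    (hN : CechAnnihilated g (Sec.lattice θ (V.basicOpen (θ h))) (g i₀ ^ N)) :
    (Sec.lattice (pullHom θ p) (p ⁻¹ᵁ V.basicOpen (θ h))).FG ∧
    ∃ N' : ℕ, CechAnnihilated g (Sec.lattice (pullHom θ p) (p ⁻¹ᵁ V.basicOpen (θ h)))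
      (g i₀ ^ N') := by
  have : Nonempty ι := ⟨i₀⟩
  have hle' : ∀ i, p ⁻¹ᵁ V.basicOpen (θ h) ≤ p ⁻¹ᵁ V.basicOpen (θ (g i)) := fun i ↦
    p.preimage_mono (H.le i)
  have hW : p ⁻¹ᵁ V.basicOpen (θ h) ≤ W.basicOpen (pullHom θ p (g i₀)) :=
    (hle' i₀).trans (preimage_basicOpen_eq _ _ _).le
  have h1 := fg_sections_and_exists_cechAnnihilated (g := g) hO
    (by rwa [Sec.sections_lattice H.smul_eq_zero (fun _ ↦ rfl) H.iSup_eq rfl H.le])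
    (B := Sec.lattice (pullHom θ p) (p ⁻¹ᵁ V.basicOpen (θ h))) H.exists_retract i₀
    (fun x hx ↦ Sec.smul_injective (H.le i₀) 1 (by rwa [pow_one, smul_zero]))
    (fun x hx ↦ Sec.smul_injective hW 1 (by rwa [pow_one, smul_zero]))
    (fun x ↦ by simpa using Sec.exists_smul_eq hW 1 x) hN
  rwa [Sec.sections_lattice H.smul_eq_zero_of_pullHom (fun i ↦ preimage_basicOpen_eq _ _ _)
    H.iSup_preimage_eq (preimage_basicOpen_eq _ _ _) hle'] at h1

end FiniteFlat

end


/-! ### Clopen subsets and idempotent functions -/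

noncomputable section

section Clopen

variable {X : Scheme.{u}}

/-- Every clopen subset of a scheme is the basic open of an idempotent. -/
lemma exists_idempotent_of_isClopen {Z : Set X} (hZ : IsClopen Z) :
    ∃ e : Γ(X, ⊤), e ^ 2 = e ∧ (X.basicOpen e : Set X) = Z := by
  let U : Bool → X.Opens := fun b ↦ if b then ⟨Z, hZ.2⟩ else ⟨Zᶜ, hZ.1.isOpen_compl⟩
  have hU : (⊤ : X.Opens) ≤ iSup U := by
    intro x _
    rw [Opens.mem_iSup]
    by_cases hx : x ∈ Z
    · exact ⟨true, hx⟩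
    · exact ⟨false, hx⟩
  let θ : Γ(X, ⊤) →+* Γ(X, ⊤) := .id _
  let s : ∀ b, Sec θ (U b) := fun b ↦ if b then 1 else 0
  have hdisj : ∀ b c, b ≠ c → U b ⊓ U c = ⊥ := by
    rintro (_ | _) (_ | _) h
    · exact (h rfl).elim
    · ext x
      simp [U]
    · ext x
      simp [U]
    · exact (h rfl).elim
  obtain ⟨e, he⟩ := Sec.exists_glue U (fun _ ↦ le_top) hU s fun b c ↦ by
    by_cases hbc : b = c
    · subst hbc
      rfl
    · have : Subsingleton Γ(X, U b ⊓ U c) := by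
        rw [hdisj b c hbc]
        infer_instance
      exact this.elim _ _
  have h2 : e ^ 2 = e := by
    refine Sec.eq_of_res_eq U (fun _ ↦ le_top) hU fun b ↦ ?_
    rw [map_pow, he]
    rcases b with _ | _
    · exact zero_pow two_ne_zero
    · exact one_pow 2
  let e' : Γ(X, ⊤) := e
  have h1 : X.presheaf.map (homOfLE (le_top : U true ≤ ⊤)).op e' = 1 := he true
  have h0 : X.presheaf.map (homOfLE (le_top : U false ≤ ⊤)).op e' = 0 := he false
  have h1' := X.basicOpen_res e' (homOfLE (le_top : U true ≤ ⊤)).op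
  have h0' := X.basicOpen_res e' (homOfLE (le_top : U false ≤ ⊤)).op
  rw [h1, Scheme.basicOpen_of_isUnit _ isUnit_one] at h1'
  rw [h0, Scheme.basicOpen_zero] at h0'
  refine ⟨e', h2, Set.ext fun x ↦ ⟨fun hx ↦ ?_, fun hx ↦ ?_⟩⟩
  · by_contra hxZ
    have : x ∈ U false ⊓ X.basicOpen e' := ⟨hxZ, hx⟩
    rw [← h0'] at this
    exact this
  · have : x ∈ U true ⊓ X.basicOpen e' := h1' ▸ (show x ∈ U true from hx)
    exact this.2

lemma isClopen_basicOpen_of_idempotent {e : Γ(X, ⊤)} (he : e ^ 2 = e) :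
    IsClopen (X.basicOpen e : Set X) := by
  refine ⟨?_, (X.basicOpen e).2⟩
  rw [← isOpen_compl_iff]
  convert (X.basicOpen (1 - e)).2 using 1
  ext x
  have h1 : X.basicOpen e ⊓ X.basicOpen (1 - e) = ⊥ := by
    rw [← Scheme.basicOpen_mul, show e * (1 - e) = 0 by linear_combination -he,
      Scheme.basicOpen_zero]
  have h2 : X.basicOpen (e + (1 - e)) ≤ X.basicOpen e ⊔ X.basicOpen (1 - e) :=
    X.basicOpen_add_le _ _
  rw [add_sub_cancel, Scheme.basicOpen_of_isUnit _ isUnit_one] at h2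
  constructor
  · intro hx
    rcases h2 (trivial : x ∈ (⊤ : X.Opens)) with h | h
    · exact (hx h).elim
    · exact h
  · intro hx hx'
    have : x ∈ X.basicOpen e ⊓ X.basicOpen (1 - e) := ⟨hx', hx⟩
    rw [h1] at this
    exact this

/-- If all idempotent functions extend along a morphism of schemes with connected target, then its
source is preconnected. -/
lemma preconnectedSpace_of_lift_idempotents {Y : Scheme.{u}} (π : Y ⟶ X) [PreconnectedSpace X]
    (h : ∀ e : Γ(Y, ⊤), e ^ 2 = e → ∃ b : Γ(X, ⊤), b ^ 2 = b ∧ π.appTop b = e) :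
    PreconnectedSpace Y := by
  rw [preconnectedSpace_iff_clopen]
  intro Z hZ
  obtain ⟨e, he, rfl⟩ := exists_idempotent_of_isClopen hZ
  obtain ⟨b, hb, rfl⟩ := h e he
  have := isClopen_iff.1 (isClopen_basicOpen_of_idempotent hb)
  rw [← Scheme.preimage_basicOpen_top]
  rcases this with h | h
  · left
    exact (congrArg (π ⁻¹' ·) h).trans Set.preimage_empty
  · right
    exact (congrArg (π ⁻¹' ·) h).trans Set.preimage_univ

end Clopen

/-! ### Lifting idempotents from the reduction of a cover -/

section Lift

variable {A : Type u} [CommRing A] {V W W₀ : Scheme.{u}} {θ : A →+* Γ(V, ⊤)} {p : W ⟶ V}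
  {π : W₀ ⟶ W} {ι : Type} {g : ι → A} {h : A}
  [CompactSpace W] [QuasiSeparatedSpace W]

lemma IsLatticeCover.isAffineOpen_inf (H : IsLatticeCover θ g h) (i j : ι) :
    IsAffineOpen (V.basicOpen (θ (g i)) ⊓ V.basicOpen (θ (g j))) := by
  have := (H.isAffineOpen i).basicOpen
    (V.presheaf.map (homOfLE (le_top : V.basicOpen (θ (g i)) ≤ ⊤)).op (θ (g j)))
  rwa [Scheme.basicOpen_res] at this

/-- If `f` divides, locally on a lattice cover, a global function, then it does so globally. -/
lemma IsLatticeCover.exists_smul_eq_of_local [IsFinite p] [Flat p] (H : IsLatticeCover θ g h)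
    (i₀ : ι) {t : Sec (pullHom θ p) (⊤ : W.Opens)}
    (ht : ∀ i, ∃ w : Sec (pullHom θ p) (p ⁻¹ᵁ V.basicOpen (θ (g i))),
      g i₀ • w = Sec.res (pullHom θ p) le_top t) :
    ∃ w, g i₀ • w = t := by
  have : Nonempty ι := ⟨i₀⟩
  have hle' : ∀ i, p ⁻¹ᵁ V.basicOpen (θ h) ≤ p ⁻¹ᵁ V.basicOpen (θ (g i)) := fun i ↦
    p.preimage_mono (H.le i)
  have hf := (hle' i₀).trans (preimage_basicOpen_eq θ p (g i₀)).le
  choose w hw using ht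
  -- The quotient `t / f` exists over `D(h)`, where `f` is invertible. By assumption it lies in
  -- every localization of the lattice, hence in the lattice.
  obtain ⟨x, hx⟩ := Sec.exists_smul_eq hf 1 (Sec.res (pullHom θ p) le_top t)
  have hx' : x ∈ (Sec.lattice (pullHom θ p) (p ⁻¹ᵁ V.basicOpen (θ h))).sections g := by
    rw [Submodule.mem_sections]
    intro i
    refine (Sec.mem_awaySaturation_lattice (preimage_basicOpen_eq θ p (g i)) (hle' i)).2
      ⟨w i, Sec.smul_injective hf 1 ?_⟩
    rw [hx, pow_one, ← map_smul, hw, Sec.res_res]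
  rw [Sec.sections_lattice H.smul_eq_zero_of_pullHom (fun i ↦ preimage_basicOpen_eq _ _ _)
    H.iSup_preimage_eq (preimage_basicOpen_eq _ _ _) hle'] at hx'
  obtain ⟨v, rfl⟩ := hx'
  refine ⟨v, Sec.res_injective H.smul_eq_zero_of_pullHom (a := 1) ?_
    (preimage_basicOpen_eq θ p h) le_top ?_⟩
  · rw [map_one, Scheme.basicOpen_of_isUnit _ isUnit_one]
  · rw [← hx, map_smul, pow_one]
    rfl

lemma IsLatticeCover.finite_of_fg_lattice [IsFinite p] [Flat p] (H : IsLatticeCover θ g h)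
    (hfg : (Sec.lattice (pullHom θ p) (p ⁻¹ᵁ V.basicOpen (θ h))).FG) :
    Module.Finite A (Sec (pullHom θ p) (⊤ : W.Opens)) := by
  have hinj := Sec.res_injective H.smul_eq_zero_of_pullHom (a := 1) (U := ⊤)
    (by rw [map_one, Scheme.basicOpen_of_isUnit _ isUnit_one])
    (preimage_basicOpen_eq θ p h) le_top
  have : Module.Finite A (LinearMap.range
      (Sec.res (pullHom θ p) (le_top : p ⁻¹ᵁ V.basicOpen (θ h) ≤ ⊤)).toLinearMap) :=
    Module.Finite.iff_fg.2 hfg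
  exact Module.Finite.equiv (LinearEquiv.ofInjective
    (Sec.res (pullHom θ p) (le_top : p ⁻¹ᵁ V.basicOpen (θ h) ≤ ⊤)).toLinearMap hinj).symm

/-- Lifting of idempotents from the reduction modulo `f` of a finite flat cover. -/
theorem IsLatticeCover.exists_lift_idempotent [IsNoetherianRing A] [IsFinite p] [Flat p]
    (H : IsLatticeCover θ g h) (i₀ : ι) [IsAdicComplete (Ideal.span {g i₀}) A]
    (hfg : (Sec.lattice (pullHom θ p) (p ⁻¹ᵁ V.basicOpen (θ h))).FG) {N : ℕ}
    (hN : CechAnnihilated g (Sec.lattice (pullHom θ p) (p ⁻¹ᵁ V.basicOpen (θ h))) (g i₀ ^ N))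
    (hsurj : ∀ U : W.Opens, IsAffineOpen U → Function.Surjective (Sec.pull (pullHom θ p) π U))
    (hker : ∀ U : W.Opens, IsAffineOpen U → ∀ x, Sec.pull (pullHom θ p) π U x = 0 →
      ∃ y, g i₀ • y = x)
    (hf : ∀ (U : W.Opens) (x : Sec (pullHom θ p) U), Sec.pull (pullHom θ p) π U (g i₀ • x) = 0)
    (e : Sec (pullHom (pullHom θ p) π) (π ⁻¹ᵁ ⊤)) (he : e ^ 2 = e) :
    ∃ b, b ^ 2 = b ∧ Sec.pull (pullHom θ p) π ⊤ b = e := by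
  set f := g i₀
  let U : ι → W.Opens := fun i ↦ p ⁻¹ᵁ V.basicOpen (θ (g i))
  let D : W.Opens := p ⁻¹ᵁ V.basicOpen (θ h)
  have hle' : ∀ i, D ≤ U i := fun i ↦ p.preimage_mono (H.le i)
  have hfD : D ≤ W.basicOpen ((pullHom θ p) f) :=
    (hle' i₀).trans (preimage_basicOpen_eq θ p (g i₀)).le
  have hUaff : ∀ i, IsAffineOpen (U i) := fun i ↦ (H.isAffineOpen i).preimage p
  have hUaff' : ∀ i j, IsAffineOpen (U i ⊓ U j) := fun i j ↦ (H.isAffineOpen_inf i j).preimage p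
  have hUij : ∀ i j, U i ⊓ U j = W.basicOpen ((pullHom θ p) (g i * g j)) := fun i j ↦ by
    rw [map_mul, Scheme.basicOpen_mul, ← preimage_basicOpen_eq, ← preimage_basicOpen_eq]
  have hdvd : ∀ {O : W.Opens} {x : Sec (pullHom θ p) O}, algebraMap A (Sec (pullHom θ p) O) f ∣ x →
      Sec.pull (pullHom θ p) π O x = 0 := by
    rintro O _ ⟨y, rfl⟩
    rw [← Algebra.smul_def, hf]
  have hdvd' : ∀ {O : W.Opens}, IsAffineOpen O → ∀ {x : Sec (pullHom θ p) O},
      Sec.pull (pullHom θ p) π O x = 0 →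
      algebraMap A (Sec (pullHom θ p) O) f ∣ x := by
    intro O hO x hx
    obtain ⟨y, rfl⟩ := hker O hO x hx
    exact ⟨y, Algebra.smul_def _ _⟩
  let E : ∀ O : W.Opens, Sec (pullHom (pullHom θ p) π) (π ⁻¹ᵁ O) := fun O ↦
    Sec.res _ (π.preimage_mono le_top) e
  have hE : ∀ O, E O ^ 2 = E O := fun O ↦ by rw [← map_pow, he]
  -- In the exponent `N + 1`, the part `N` is spent on trivializing the cocycle; the remaining
  -- factor `f` keeps the correction of `b i` invisible on the reduction.
  have hb : ∀ i, ∃ b : Sec (pullHom θ p) (U i), Sec.pull (pullHom θ p) π (U i) b = E (U i) ∧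
      algebraMap A _ f ^ (N + 1) ∣ b ^ 2 - b := by
    intro i
    obtain ⟨a, ha⟩ := hsurj (U i) (hUaff i) (E (U i))
    obtain ⟨b, hb1, hb2⟩ := exists_lift_idempotent_mod_pow
      (f := algebraMap A (Sec (pullHom θ p) (U i)) f) (a := a) (hdvd' (hUaff i) (by rw [map_sub, map_pow, ha, hE, sub_self])) (N + 1)
    refine ⟨b, ?_, hb2⟩
    rw [← ha, ← sub_eq_zero, ← map_sub, hdvd hb1]
  choose b hbE hb2 using hb
  have hc : ∀ i j, ∃ c : Sec (pullHom θ p) (U i ⊓ U j), f ^ (N + 1) • c =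
      Sec.res (pullHom θ p) inf_le_left (b i) - Sec.res (pullHom θ p) inf_le_right (b j) := by
    intro i j
    have h1 : ∀ k (hk : U i ⊓ U j ≤ U k), algebraMap A (Sec (pullHom θ p) (U i ⊓ U j)) f ^ (N + 1) ∣
        Sec.res (pullHom θ p) hk (b k) ^ 2 - Sec.res (pullHom θ p) hk (b k) := by
      intro k hk
      have := map_dvd (Sec.res (pullHom θ p) hk) (hb2 k)
      rwa [map_pow, AlgHom.commutes, map_sub, map_pow] at this
    have h2 : ∀ k (hk : U i ⊓ U j ≤ U k),
        Sec.pull (pullHom θ p) π (U i ⊓ U j) (Sec.res (pullHom θ p) hk (b k)) = E (U i ⊓ U j) := by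
      intro k hk
      rw [Sec.pull_res, hbE, Sec.res_res]
    obtain ⟨c, hc⟩ := dvd_sub_of_idempotent_mod_pow (h1 i inf_le_left) (h1 j inf_le_right)
      (hdvd' (hUaff' i j) (by rw [map_sub, h2, h2, sub_self]))
    exact ⟨c, by rw [hc, Algebra.smul_def, map_pow]⟩
  choose c hc using hc
  have hcD : ∀ i j, f ^ (N + 1) • Sec.res (pullHom θ p) (le_inf (hle' i) (hle' j)) (c i j) =
      Sec.res (pullHom θ p) (hle' i) (b i) - Sec.res (pullHom θ p) (hle' j) (b j) := by
    intro i j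
    rw [← map_smul, hc, map_sub, Sec.res_res, Sec.res_res]
  obtain ⟨d, hd, hcd⟩ := hN (fun i j ↦ Sec.res (pullHom θ p) (le_inf (hle' i) (hle' j)) (c i j))
    (fun i j ↦ (Sec.mem_awaySaturation_lattice (hUij i j) _).2 ⟨_, rfl⟩) fun i j k ↦ by
      refine Sec.smul_injective hfD (N + 1) ?_
      rw [smul_add, hcD, hcD, hcD, sub_add_sub_cancel]
  have hy : ∀ i, ∃ y, Sec.res (pullHom θ p) (hle' i) y = d i := fun i ↦
    (Sec.mem_awaySaturation_lattice (preimage_basicOpen_eq θ p (g i)) (hle' i)).1 (hd i)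
  choose y hy using hy
  obtain ⟨t, ht⟩ := Sec.exists_glue U (V := ⊤) (fun _ ↦ le_top) H.iSup_preimage_eq.ge
    (fun i ↦ b i - f • y i) fun i j ↦ by
      refine Sec.res_injective H.smul_eq_zero_of_pullHom (hUij i j) (preimage_basicOpen_eq θ p h)
        (le_inf (hle' i) (hle' j)) ?_
      rw [Sec.res_res, Sec.res_res, map_sub, map_sub, map_smul, map_smul, hy, hy,
        sub_eq_sub_iff_sub_eq_sub, ← hcD, ← smul_sub, ← hcd, smul_smul, pow_succ']
  have hte : Sec.pull (pullHom θ p) π ⊤ t = e := by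
    refine Sec.eq_of_res_eq (fun i ↦ π ⁻¹ᵁ U i) (fun i ↦ π.preimage_mono (le_top : U i ≤ ⊤)) ?_
      fun i ↦ ?_
    · rw [← Scheme.Hom.preimage_iSup, H.iSup_preimage_eq]
    · rw [← Sec.pull_res (le_top : U i ≤ ⊤), ht, map_sub, hf, sub_zero, hbE]
  obtain ⟨w, hw⟩ := H.exists_smul_eq_of_local (p := p) i₀ (t := t ^ 2 - t) fun i ↦ by
    refine hker _ (hUaff i) _ ?_
    rw [Sec.pull_res, map_sub, map_pow, hte, he, sub_self, map_zero]
  have := H.finite_of_fg_lattice hfg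
  obtain ⟨b', hb', hb't⟩ := exists_isIdempotentElem_of_finite (R := A) (f := f) (a := t)
    ⟨w, by rw [← hw, Algebra.smul_def]⟩
  refine ⟨b', hb', ?_⟩
  rw [← hte, ← sub_eq_zero, ← map_sub, hdvd hb't]

/-- The reduction modulo `f` of a non-empty finite flat cover is non-empty. -/
theorem IsLatticeCover.nonempty_of_nonempty [IsLocalRing A] [IsFinite p] [Flat p]
    (H : IsLatticeCover θ g h) (i₀ : ι) (hf : g i₀ ∈ IsLocalRing.maximalIdeal A)
    (hfg : (Sec.lattice (pullHom θ p) (p ⁻¹ᵁ V.basicOpen (θ h))).FG)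
    (hker : ∀ U : W.Opens, IsAffineOpen U → ∀ x, Sec.pull (pullHom θ p) π U x = 0 →
      ∃ y, g i₀ • y = x) [Nonempty W] : Nonempty W₀ := by
  by_contra hW
  rw [not_nonempty_iff] at hW
  obtain ⟨w, hw⟩ := H.exists_smul_eq_of_local (p := p) i₀ (t := 1) fun i ↦ by
    refine hker _ ((H.isAffineOpen i).preimage p) _ ?_
    have : Subsingleton Γ(W₀, π ⁻¹ᵁ p ⁻¹ᵁ V.basicOpen (θ (g i))) := by
      rw [show π ⁻¹ᵁ p ⁻¹ᵁ V.basicOpen (θ (g i)) = ⊥ from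
        Opens.ext (Set.eq_empty_of_isEmpty _)]
      infer_instance
    exact this.elim _ _
  have := H.finite_of_fg_lattice hfg
  -- The relation `1 = f • w` makes the finite module of global functions equal to `f` times itself.
  have h0 : (⊤ : Submodule A (Sec (pullHom θ p) (⊤ : W.Opens))) = ⊥ := by
    refine Submodule.eq_bot_of_le_smul_of_le_jacobson_bot (Ideal.span {g i₀}) _
      Module.Finite.fg_top ?_ ?_
    · intro x _
      rw [← mul_one x, ← hw, Algebra.mul_smul_comm]
      exact Submodule.smul_mem_smul (Ideal.mem_span_singleton_self _) trivial
    · rw [IsLocalRing.jacobson_eq_maximalIdeal _ bot_ne_top]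
      exact (Ideal.span_singleton_le_iff_mem _).2 hf
  have h1 : (1 : Γ(W, ⊤)) = 0 := by
    have : (1 : Sec (pullHom θ p) (⊤ : W.Opens)) ∈ (⊥ : Submodule A _) := h0 ▸ trivial
    exact this
  obtain ⟨x⟩ := ‹Nonempty W›
  have h2 : x ∈ W.basicOpen (1 : Γ(W, ⊤)) := by
    rw [Scheme.basicOpen_of_isUnit _ isUnit_one]
    trivial
  rw [h1, Scheme.basicOpen_zero] at h2
  exact h2

end Lift

end


/-! ### Functions on the reduction modulo `f` -/

noncomputable section

section PushoutQuotient

/-- The pushout of a surjection of rings whose kernel is generated by `r` is a surjection whose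
kernel is generated by the image of `r`. -/
lemma isPushout_surjective_and_ker {R B C P : CommRingCat.{u}} {φ : R ⟶ B} {q : R ⟶ C}
    {i : B ⟶ P} {j : C ⟶ P} (h : IsPushout φ q i j) (hq : Function.Surjective q) (r : R)
    (hr : q r = 0) (hker : ∀ x, q x = 0 → r ∣ x) :
    Function.Surjective i ∧ i (φ r) = 0 ∧ ∀ x, i x = 0 → φ r ∣ x := by
  have hir : i (φ r) = 0 := by
    have := ConcreteCategory.congr_hom h.w r
    rw [CommRingCat.comp_apply, CommRingCat.comp_apply, hr, map_zero] at this
    exact this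
  -- The pushout is compared with `B ⧸ J`: the composite `d ≫ l` is the identity, which makes `i`
  -- surjective, and `i ≫ d = m` bounds its kernel by `J`.
  let J : Ideal B := Ideal.span {φ r}
  let m : B ⟶ .of (B ⧸ J) := CommRingCat.ofHom (Ideal.Quotient.mk J)
  have hkq : RingHom.ker q.hom ≤ RingHom.ker (φ ≫ m).hom := by
    intro x hx
    obtain ⟨y, rfl⟩ := hker x hx
    rw [RingHom.mem_ker]
    refine Ideal.Quotient.eq_zero_iff_mem.2 (Ideal.mem_span_singleton.2 ?_)
    exact ⟨φ y, map_mul φ.hom r y⟩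
  let d' : C ⟶ .of (B ⧸ J) := CommRingCat.ofHom
    (RingHom.liftOfSurjective q.hom hq ⟨(φ ≫ m).hom, hkq⟩)
  have hd' : φ ≫ m = q ≫ d' := by
    ext x
    exact (RingHom.liftOfRightInverse_comp_apply q.hom (Function.surjInv hq)
      (Function.rightInverse_surjInv hq) ⟨(φ ≫ m).hom, hkq⟩ x).symm
  let d : P ⟶ .of (B ⧸ J) := h.desc m d' hd'
  have hd : i ≫ d = m := h.inl_desc _ _ _
  have hJ : ∀ a ∈ J, i.hom a = 0 := by
    intro a ha
    obtain ⟨c, rfl⟩ := Ideal.mem_span_singleton.1 ha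
    rw [map_mul]
    exact (congrArg (· * i.hom c) hir).trans (zero_mul _)
  let l : CommRingCat.of (B ⧸ J) ⟶ P := CommRingCat.ofHom (Ideal.Quotient.lift J i.hom hJ)
  have hl : m ≫ l = i := by
    ext x
    rfl
  have hdl : d ≫ l = 𝟙 P := by
    refine h.hom_ext ?_ ?_
    · rw [← Category.assoc, hd, hl, Category.comp_id]
    · ext c
      obtain ⟨x, rfl⟩ := hq c
      have h1 : q ≫ j ≫ d ≫ l = q ≫ j := by
        rw [← Category.assoc, ← h.w, Category.assoc, ← Category.assoc i, hd, hl]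
      rw [Category.comp_id]
      exact ConcreteCategory.congr_hom h1 x
  refine ⟨fun y ↦ ?_, hir, fun x hx ↦ ?_⟩
  · obtain ⟨b, hb⟩ := Ideal.Quotient.mk_surjective (d y)
    refine ⟨b, ?_⟩
    have h1 := ConcreteCategory.congr_hom hdl y
    have h2 := ConcreteCategory.congr_hom hl b
    refine h2.symm.trans (Eq.trans ?_ h1)
    exact congrArg l hb
  · have h1 := ConcreteCategory.congr_hom hd x
    rw [CommRingCat.comp_apply, hx, map_zero] at h1
    exact Ideal.mem_span_singleton.1 (Ideal.Quotient.eq_zero_iff_mem.1 h1.symm)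

end PushoutQuotient

section Reduction

variable {A : Type u} [CommRing A] {f : A}

lemma specQuotient_appTop_surjective :
    Function.Surjective (specQuotient f).appTop := by
  have h := Scheme.ΓSpecIso_inv_naturality
    (CommRingCat.ofHom (Ideal.Quotient.mk (Ideal.span {f})))
  intro y
  obtain ⟨a, ha⟩ := Ideal.Quotient.mk_surjective
    ((Scheme.ΓSpecIso (.of (A ⧸ Ideal.span {f}))).hom y)
  refine ⟨(Scheme.ΓSpecIso (.of A)).inv a, ?_⟩
  have h1 := ConcreteCategory.congr_hom h a
  refine h1.symm.trans ?_
  refine (congrArg (Scheme.ΓSpecIso (.of (A ⧸ Ideal.span {f}))).inv ha).trans ?_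
  exact ConcreteCategory.congr_hom (Scheme.ΓSpecIso (.of (A ⧸ Ideal.span {f}))).hom_inv_id y

lemma specQuotient_appTop_eq_zero_iff (x : Γ(Spec (.of A), ⊤)) :
    (specQuotient f).appTop x = 0 ↔ (Scheme.ΓSpecIso (.of A)).inv f ∣ x := by
  have h := Scheme.ΓSpecIso_inv_naturality
    (CommRingCat.ofHom (Ideal.Quotient.mk (Ideal.span {f})))
  obtain ⟨a, rfl⟩ : ∃ a, (Scheme.ΓSpecIso (.of A)).inv a = x :=
    ⟨(Scheme.ΓSpecIso (.of A)).hom x,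
      ConcreteCategory.congr_hom (Scheme.ΓSpecIso (.of A)).hom_inv_id x⟩
  have h1 : (Scheme.ΓSpecIso (.of (A ⧸ Ideal.span {f}))).inv
      (Ideal.Quotient.mk (Ideal.span {f}) a) =
      (specQuotient f).appTop ((Scheme.ΓSpecIso (.of A)).inv a) :=
    ConcreteCategory.congr_hom h a
  let e₁ := (Scheme.ΓSpecIso (.of (A ⧸ Ideal.span {f}))).symm.commRingCatIsoToRingEquiv
  let e₂ := (Scheme.ΓSpecIso (.of A)).symm.commRingCatIsoToRingEquiv
  rw [← h1]
  change e₁ _ = 0 ↔ e₂ f ∣ e₂ a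
  rw [map_dvd_iff, EmbeddingLike.map_eq_zero_iff, Ideal.Quotient.eq_zero_iff_mem,
    Ideal.mem_span_singleton]

variable [IsLocalRing A] {W : Scheme.{u}} (p : W ⟶ (puncturedSpec A).toScheme)

/-- Over the affine base `Spec A`, sections of a fibre product with `Spec (A / f)` above an affine
open of `W` are a pushout of rings, so the reduction is computed by dividing by `f`. -/
lemma isPullback_reduction :
    IsPullback (pullback.fst p (puncturedSpecQuotientMap f))
      (pullback.snd p (puncturedSpecQuotientMap f) ≫ (puncturedSpecQuotient f).ι)
      (p ≫ (puncturedSpec A).ι) (specQuotient f) :=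
  ((IsPullback.of_hasPullback p (puncturedSpecQuotientMap f)).flip.paste_horiz
    (isPullback_morphismRestrict (specQuotient f) (puncturedSpec A)).flip).flip

lemma reduction_pull_smul (U : W.Opens) (x : Sec (pullHom (toGlobalPuncturedSpec A) p) U) :
    Sec.pull (pullHom (toGlobalPuncturedSpec A) p)
      (pullback.fst p (puncturedSpecQuotientMap f)) U (f • x) = 0 := by
  have h := (isPullback_reduction (f := f) p).w
  have h0 : (pullback.fst p (puncturedSpecQuotientMap f) ≫ p ≫ (puncturedSpec A).ι).appTop
      ((Scheme.ΓSpecIso (.of A)).inv f) = 0 := by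
    rw [h, Scheme.Hom.comp_appTop, CommRingCat.comp_apply,
      (specQuotient_appTop_eq_zero_iff ((Scheme.ΓSpecIso (.of A)).inv f)).2 dvd_rfl, map_zero]
  have h1 : algebraMap A (Sec (pullHom (pullHom (toGlobalPuncturedSpec A) p)
      (pullback.fst p (puncturedSpecQuotientMap f)))
      (pullback.fst p (puncturedSpecQuotientMap f) ⁻¹ᵁ U)) f = 0 :=
    (congrArg ((pullback p (puncturedSpecQuotientMap f)).presheaf.map
      (homOfLE (le_top : pullback.fst p (puncturedSpecQuotientMap f) ⁻¹ᵁ U ≤ ⊤)).op) h0).trans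
      (map_zero _)
  rw [Algebra.smul_def, map_mul, AlgHom.commutes, h1, zero_mul]

/-- The sections over an affine open subset of the reduction modulo `f`. -/
lemma reduction_surjective_and_ker {U : W.Opens} (hU : IsAffineOpen U) :
    Function.Surjective (Sec.pull (pullHom (toGlobalPuncturedSpec A) p)
      (pullback.fst p (puncturedSpecQuotientMap f)) U) ∧
    ∀ x, Sec.pull (pullHom (toGlobalPuncturedSpec A) p)
      (pullback.fst p (puncturedSpecQuotientMap f)) U x = 0 → ∃ y, f • y = x := by
  have H := isPullback_reduction (f := f) p
  have hiso := isIso_pushoutSection_of_isAffineOpen H (US := ⊤) (UT := ⊤) (UX := U)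
    (UY := pullback.fst p (puncturedSpecQuotientMap f) ⁻¹ᵁ U) le_top le_top (by simp)
    (isAffineOpen_top _) (isAffineOpen_top _) hU
  have hpo := (isIso_pushoutSection_iff H le_top le_top (by simp)).1 hiso
  have hq : (specQuotient f).appLE ⊤ ⊤ le_top = (specQuotient f).appTop := by
    rw [Scheme.Hom.appTop, Scheme.Hom.app_eq_appLE]
    rfl
  have hff := (specQuotient_appTop_eq_zero_iff ((Scheme.ΓSpecIso (.of A)).inv f)).2 dvd_rfl
  obtain ⟨h1, h2, h3⟩ := isPushout_surjective_and_ker hpo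
    (by rw [hq]; exact specQuotient_appTop_surjective) ((Scheme.ΓSpecIso (.of A)).inv f)
    (by rw [hq]; exact hff) (by
      rw [hq]
      exact fun x ↦ (specQuotient_appTop_eq_zero_iff x).1)
  have h4 : (p ≫ (puncturedSpec A).ι).appLE ⊤ U le_top ((Scheme.ΓSpecIso (.of A)).inv f) =
      algebraMap A (Sec (pullHom (toGlobalPuncturedSpec A) p) U) f := by
    simp only [Scheme.Hom.appLE, CommRingCat.comp_apply]
    rfl
  have h5 : (pullback.fst p (puncturedSpecQuotientMap f)).appLE U
      (pullback.fst p (puncturedSpecQuotientMap f) ⁻¹ᵁ U) (by simp) =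
      (pullback.fst p (puncturedSpecQuotientMap f)).app U :=
    (Scheme.Hom.app_eq_appLE _).symm
  refine ⟨fun y ↦ ?_, fun x hx ↦ ?_⟩
  · obtain ⟨x, hx⟩ := h1 y
    exact ⟨x, (ConcreteCategory.congr_hom h5 x).symm.trans hx⟩
  · obtain ⟨y, hy⟩ := h3 x ((ConcreteCategory.congr_hom h5 x).trans hx)
    rw [h4] at hy
    exact ⟨y, (Algebra.smul_def (A := Sec (pullHom (toGlobalPuncturedSpec A) p) U) f y).trans
      hy.symm⟩

end Reduction

end


/-! ### The punctured spectrum and its covers by basic opens -/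

noncomputable section

section PuncturedSpectrum

variable {A : Type u} [CommRing A] [IsLocalRing A]

lemma basicOpen_toGlobalPuncturedSpec (a : A) :
    (puncturedSpec A).toScheme.basicOpen (toGlobalPuncturedSpec A a) =
      (puncturedSpec A).ι ⁻¹ᵁ (PrimeSpectrum.basicOpen a : (Spec (.of A)).Opens) := by
  rw [← basicOpen_eq_of_affine (R := .of A) a]
  exact (Scheme.preimage_basicOpen_top (puncturedSpec A).ι
    ((Scheme.ΓSpecIso (.of A)).inv a)).symm

lemma basicOpen_le_puncturedSpec {a : A} (ha : a ∈ IsLocalRing.maximalIdeal A) :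
    (PrimeSpectrum.basicOpen a : (Spec (.of A)).Opens) ≤ puncturedSpec A := by
  rintro x hx rfl
  exact hx ha

lemma isAffineOpen_basicOpen_toGlobalPuncturedSpec {a : A}
    (ha : a ∈ IsLocalRing.maximalIdeal A) :
    IsAffineOpen ((puncturedSpec A).toScheme.basicOpen (toGlobalPuncturedSpec A a)) := by
  rw [basicOpen_toGlobalPuncturedSpec]
  refine IsAffineOpen.preimage_of_isOpenImmersion ?_ _ ?_
  · rw [← basicOpen_eq_of_affine (R := .of A) a]
    exact (isAffineOpen_top (Spec (.of A))).basicOpen _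
  · rw [Scheme.Opens.opensRange_ι]
    exact basicOpen_le_puncturedSpec ha

lemma iSup_basicOpen_toGlobalPuncturedSpec {ι : Type} {g : ι → A}
    (hg : IsLocalRing.maximalIdeal A ≤ Ideal.span (Set.range g)) :
    ⨆ i, (puncturedSpec A).toScheme.basicOpen (toGlobalPuncturedSpec A (g i)) = ⊤ := by
  rw [eq_top_iff]
  intro x _
  rw [Opens.mem_iSup]
  by_contra! hx
  refine x.2 (PrimeSpectrum.ext ?_)
  have hle : IsLocalRing.maximalIdeal A ≤ x.1.asIdeal := by
    refine hg.trans (Ideal.span_le.2 ?_)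
    rintro _ ⟨i, rfl⟩
    by_contra h
    refine hx i ?_
    rw [basicOpen_toGlobalPuncturedSpec]
    exact h
  exact ((IsLocalRing.maximalIdeal.isMaximal A).eq_of_le x.1.2.ne_top hle).symm

variable [IsDomain A]

lemma nonempty_basicOpen_toGlobalPuncturedSpec {a h : A} (ha : a ∈ IsLocalRing.maximalIdeal A)
    (ha₀ : a ≠ 0) (hh : h ≠ 0) :
    ∃ x, x ∈ (puncturedSpec A).toScheme.basicOpen (toGlobalPuncturedSpec A h) := by
  refine ⟨⟨(⊥ : PrimeSpectrum A), fun hb ↦ ha₀ ?_⟩, ?_⟩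
  · have h1 : (⊥ : PrimeSpectrum A) = IsLocalRing.closedPoint A := hb
    have h2 : a ∈ (⊥ : PrimeSpectrum A).asIdeal := by
      rw [h1]
      exact ha
    exact h2
  · rw [basicOpen_toGlobalPuncturedSpec]
    exact hh

lemma isIntegral_puncturedSpec {a : A} (ha : a ∈ IsLocalRing.maximalIdeal A) (ha₀ : a ≠ 0) :
    IsIntegral (puncturedSpec A).toScheme := by
  obtain ⟨x, -⟩ := nonempty_basicOpen_toGlobalPuncturedSpec ha ha₀ ha₀
  have : Nonempty (puncturedSpec A).toScheme := ⟨x⟩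
  exact isIntegral_of_isOpenImmersion (puncturedSpec A).ι

lemma isLatticeCover_puncturedSpec [IsNoetherianRing A] {n : ℕ} {g : Fin n → A}
    (hg : ∀ i, g i ∈ IsLocalRing.maximalIdeal A) (hg₀ : ∀ i, g i ≠ 0)
    (hspan : IsLocalRing.maximalIdeal A ≤ Ideal.span (Set.range g)) :
    IsLatticeCover (toGlobalPuncturedSpec A) g (∏ i, g i) := by
  have hle : ∀ i, (puncturedSpec A).toScheme.basicOpen (toGlobalPuncturedSpec A (∏ i, g i)) ≤
      (puncturedSpec A).toScheme.basicOpen (toGlobalPuncturedSpec A (g i)) := fun i ↦ by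
    obtain ⟨c, hc⟩ := Finset.dvd_prod_of_mem g (Finset.mem_univ i)
    rw [hc, map_mul, Scheme.basicOpen_mul]
    exact inf_le_left
  have hp : ∏ i, g i ≠ 0 := Finset.prod_ne_zero_iff.2 fun i _ ↦ hg₀ i
  refine ⟨fun i ↦ isAffineOpen_basicOpen_toGlobalPuncturedSpec (hg i), fun i ↦ ?_,
    iSup_basicOpen_toGlobalPuncturedSpec hspan, hle, fun i b hb ↦ ?_⟩
  · exact IsLocallyNoetherian.component_noetherian
      ⟨_, isAffineOpen_basicOpen_toGlobalPuncturedSpec (hg i)⟩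
  · have := isIntegral_puncturedSpec (hg i) (hg₀ i)
    obtain ⟨x, hx⟩ := nonempty_basicOpen_toGlobalPuncturedSpec (hg i) (hg₀ i) hp
    let U := (puncturedSpec A).toScheme.basicOpen (toGlobalPuncturedSpec A (g i))
    have : Nonempty U := ⟨⟨x, hle i hx⟩⟩
    let c : Γ((puncturedSpec A).toScheme, U) :=
      (puncturedSpec A).toScheme.presheaf.map (homOfLE (le_top : U ≤ ⊤)).op
        (toGlobalPuncturedSpec A (∏ i, g i))
    have hc : c ≠ 0 := by
      intro hc
      have h1 := (puncturedSpec A).toScheme.basicOpen_res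
        (toGlobalPuncturedSpec A (∏ i, g i)) (homOfLE (le_top : U ≤ ⊤)).op
      have h2 : x ∈ (puncturedSpec A).toScheme.basicOpen c := h1 ▸ ⟨hle i hx, hx⟩
      rw [hc, Scheme.basicOpen_zero] at h2
      exact h2
    let b' : Γ((puncturedSpec A).toScheme, U) := b
    have hcb : c * b' = 0 := hb
    exact (mul_eq_zero.1 hcb).resolve_left hc

omit [IsDomain A] in
-- Including `f` makes `D(f)` a member of the cover; discarding zero keeps the product of the
-- generators nonzero.
lemma exists_generators [IsNoetherianRing A] {f : A} (hf : f ∈ IsLocalRing.maximalIdeal A)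
    (hf₀ : f ≠ 0) : ∃ (n : ℕ) (g : Fin n → A) (i₀ : Fin n),
      (∀ i, g i ∈ IsLocalRing.maximalIdeal A) ∧ (∀ i, g i ≠ 0) ∧
      IsLocalRing.maximalIdeal A ≤ Ideal.span (Set.range g) ∧ g i₀ = f := by
  classical
  obtain ⟨t, ht⟩ := (isNoetherianRing_iff_ideal_fg A).1 inferInstance (IsLocalRing.maximalIdeal A)
  let T : Finset A := insert f (t.erase 0)
  let e := T.equivFin
  have hT : ∀ x ∈ T, x ∈ IsLocalRing.maximalIdeal A ∧ x ≠ 0 := by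
    intro x hx
    rcases Finset.mem_insert.1 hx with rfl | hx
    · exact ⟨hf, hf₀⟩
    · exact ⟨ht ▸ Ideal.subset_span (Finset.mem_of_mem_erase hx), Finset.ne_of_mem_erase hx⟩
  refine ⟨T.card, fun i ↦ (e.symm i).1, e ⟨f, Finset.mem_insert_self _ _⟩,
    fun i ↦ (hT _ (e.symm i).2).1, fun i ↦ (hT _ (e.symm i).2).2, ?_, by simp⟩
  rw [← ht]
  refine Submodule.span_le.2 fun x hx ↦ ?_
  by_cases hx₀ : x = 0
  · rw [hx₀]
    exact Submodule.zero_mem _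
  · exact Ideal.subset_span ⟨e ⟨x, Finset.mem_insert_of_mem (Finset.mem_erase.2 ⟨hx₀, hx⟩)⟩,
      by simp⟩

end PuncturedSpectrum

/-! ### The hypothesis on `H¹` in Čech form -/

section CechAnnihilator

variable {A : Type u} [CommRing A] {X : Scheme.{u}} [CompactSpace X] [QuasiSeparatedSpace X]
  {θ : A →+* Γ(X, ⊤)} {ι : Type} {g : ι → A} {h : A}

/-- An element annihilating `H¹` of the structure sheaf annihilates Čech cohomology. -/
lemma IsLatticeCover.cechAnnihilated (H : IsLatticeCover θ g h) {a : A}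
    (ha : ∀ ξ : structureCohomology X 1, mulStructureCohomology (θ a) 1 ξ = 0) :
    CechAnnihilated g (Sec.lattice θ (X.basicOpen (θ h))) a := by
  intro c hc hcoc
  let U : ι → X.Opens := fun i ↦ X.basicOpen (θ (g i))
  have hUij : ∀ i j, U i ⊓ U j = X.basicOpen (θ (g i * g j)) := fun i j ↦ by
    rw [map_mul, Scheme.basicOpen_mul]
  have hUijk : ∀ i j k, U i ⊓ U j ⊓ U k = X.basicOpen (θ (g i * g j * g k)) := fun i j k ↦ by
    rw [map_mul, Scheme.basicOpen_mul, hUij]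
  have hy := fun i j ↦ (Sec.mem_awaySaturation_lattice (hUij i j)
    (le_inf (H.le i) (H.le j))).1 (hc i j)
  choose y hy using hy
  have hyc : ∀ i j k,
      Sec.res θ (show U i ⊓ U j ⊓ U k ≤ U i ⊓ U j from inf_le_left) (y i j) +
      Sec.res θ (show U i ⊓ U j ⊓ U k ≤ U j ⊓ U k from inf_le_inf_right _ inf_le_right) (y j k) =
      Sec.res θ (show U i ⊓ U j ⊓ U k ≤ U i ⊓ U k from inf_le_inf_right _ inf_le_left) (y i k) := by
    intro i j k
    refine Sec.res_injective (θ := θ) H.smul_eq_zero (hUijk i j k) rfl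
      (le_inf (le_inf (H.le i) (H.le j)) (H.le k)) ?_
    rw [map_add, Sec.res_res, Sec.res_res, Sec.res_res, hy, hy, hy, hcoc]
  obtain ⟨d, hd⟩ := exists_coboundary (F := structureAbSheaf X) (U := U)
    (mulStructureAbSheaf (θ a)) ha H.iSup_eq y hyc
  let d' : ∀ i, Sec θ (U i) := d
  refine ⟨fun i ↦ Sec.res θ (H.le i) (d' i), fun i ↦
    (Sec.mem_awaySaturation_lattice rfl (H.le i)).2 ⟨_, rfl⟩, fun i j ↦ ?_⟩
  have h1 : a • y i j = Sec.res θ inf_le_left (d' i) - Sec.res θ inf_le_right (d' j) := hd i j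
  have h2 := congrArg (Sec.res θ (le_inf (H.le i) (H.le j))) h1
  rwa [map_smul, hy, map_sub, Sec.res_res, Sec.res_res] at h2

end CechAnnihilator

/-! ### Connectedness of the reduction of a connected cover -/

section Lefschetz

variable {A : Type u} [CommRing A] [IsDomain A] [IsLocalRing A] [IsNoetherianRing A] {f : A}

/-- Connectedness of the reduction modulo `f` of a connected finite flat cover of the punctured
spectrum. -/
theorem connectedSpace_reduction (hf₀ : f ≠ 0) (hf : f ∈ IsLocalRing.maximalIdeal A)
    (hcomplete : IsAdicComplete (Ideal.span {f}) A) (hH0 : (toGlobalPuncturedSpec A).Finite)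
    (hH1 : ∃ N : ℕ, ∀ ξ : structureCohomology (puncturedSpec A).toScheme 1,
      mulStructureCohomology (toGlobalPuncturedSpec A (f ^ N)) 1 ξ = 0)
    {W : Scheme.{u}} (p : W ⟶ (puncturedSpec A).toScheme) [IsFinite p] [Flat p]
    [ConnectedSpace W] : ConnectedSpace ↥(pullback p (puncturedSpecQuotientMap f)) := by
  obtain ⟨n, g, i₀, hg, hg₀, hspan, rfl⟩ := exists_generators hf hf₀
  have H := isLatticeCover_puncturedSpec hg hg₀ hspan
  have : Nonempty (Fin n) := ⟨i₀⟩
  have : CompactSpace (puncturedSpec A).toScheme :=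
    isCompact_iff_compactSpace.1 (NoetherianSpace.isCompact _)
  have : CompactSpace W := QuasiCompact.compactSpace_of_compactSpace p
  have : QuasiSeparatedSpace W := quasiSeparatedSpace_of_quasiSeparated p
  obtain ⟨N, hN⟩ := hH1
  have hfin : Module.Finite A (Sec (toGlobalPuncturedSpec A)
      (⊤ : (puncturedSpec A).toScheme.Opens)) := by
    have h1 : algebraMap A (Sec (toGlobalPuncturedSpec A) ⊤) = toGlobalPuncturedSpec A :=
      RingHom.ext fun a ↦ Sec.res_self (θ := toGlobalPuncturedSpec A) (toGlobalPuncturedSpec A a)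
    rw [← RingHom.finite_algebraMap, h1]
    exact hH0
  have hO : (Sec.lattice (toGlobalPuncturedSpec A) ((puncturedSpec A).toScheme.basicOpen
      (toGlobalPuncturedSpec A (∏ i, g i)))).FG := by
    rw [Sec.lattice, LinearMap.range_eq_map]
    exact Module.Finite.fg_top.map _
  obtain ⟨hfg, N', hN'⟩ := H.fg_lattice_and_exists_cechAnnihilated (p := p) hO i₀
    (H.cechAnnihilated hN)
  have hker := fun (U : W.Opens) (hU : IsAffineOpen U) ↦
    (reduction_surjective_and_ker (f := g i₀) p hU).2
  have : Nonempty ↥(pullback p (puncturedSpecQuotientMap (g i₀))) :=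
    H.nonempty_of_nonempty i₀ hf hfg hker
  have : PreconnectedSpace ↥(pullback p (puncturedSpecQuotientMap (g i₀))) :=
    preconnectedSpace_of_lift_idempotents (pullback.fst p (puncturedSpecQuotientMap (g i₀)))
      fun e he ↦ H.exists_lift_idempotent i₀ hfg hN'
        (fun U hU ↦ (reduction_surjective_and_ker (f := g i₀) p hU).1) hker
        (fun U x ↦ reduction_pull_smul p U x) e he
  exact { toNonempty := inferInstance }

end Lefschetz

end


/-! ### Finite étale covers and their fibre functors -/

noncomputable section

/-- An irreducible component that meets a connected component lies in it. The complement is thus a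
union of irreducible components, of which there are finitely many, all closed. -/
lemma TopologicalSpace.NoetherianSpace.isOpen_connectedComponent' {α : Type*} [TopologicalSpace α]
    [NoetherianSpace α] (x : α) : IsOpen (connectedComponent x) := by
  have h : (connectedComponent x)ᶜ =
      ⋃ T ∈ {T ∈ irreducibleComponents α | Disjoint T (connectedComponent x)}, T := by
    ext y
    simp only [Set.mem_compl_iff, Set.mem_iUnion, Set.mem_ofPred_eq, exists_prop]
    constructor
    · intro hy
      refine ⟨irreducibleComponent y, ⟨irreducibleComponent_mem_irreducibleComponents y, ?_⟩,
        mem_irreducibleComponent⟩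
      rw [Set.disjoint_left]
      intro z hz hzx
      refine hy ?_
      rw [connectedComponent_eq hzx]
      exact isIrreducible_irreducibleComponent.isConnected.isPreconnected.subset_connectedComponent
        hz mem_irreducibleComponent
    · rintro ⟨T, ⟨-, hT⟩, hy⟩ hyx
      exact Set.disjoint_left.1 hT hy hyx
  rw [← isClosed_compl_iff, h]
  exact (NoetherianSpace.finite_irreducibleComponents.subset (Set.sep_subset _ _)).isClosed_biUnion
    fun T hT ↦ isClosed_of_mem_irreducibleComponents T hT.1

section FiniteEtale

instance : finiteEtale.{u}.IsMultiplicative where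
  id_mem _ := ⟨inferInstance, inferInstance⟩
  comp_mem f g hf hg := by
    have := hf.1
    have := hf.2
    have := hg.1
    have := hg.2
    exact ⟨inferInstance, inferInstance⟩

instance : finiteEtale.{u}.HasOfPostcompProperty finiteEtale.{u} where
  of_postcomp f g hg hfg := by
    have := hg.1
    have := hg.2
    have := hfg.1
    have := hfg.2
    exact ⟨IsFinite.of_comp f g, Etale.of_comp f g⟩

variable {X : Scheme.{u}}

instance (Y : FEt X) : IsFinite Y.hom := Y.prop.1

instance (Y : FEt X) : Etale Y.hom := Y.prop.2

lemma isClosedImmersion_ι {Y : Scheme.{u}} {U : Y.Opens} (hU : IsClosed (U : Set Y)) :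
    IsClosedImmersion U.ι where
  isClosedEmbedding := ⟨U.ι.isOpenEmbedding.isEmbedding, by simpa using hU⟩

/-- An open and closed subscheme of a finite étale cover. -/
def FEt.restrict (Y : FEt X) (U : Y.left.Opens) (hU : IsClosed (U : Set Y.left)) : FEt X :=
  MorphismProperty.Over.mk ⊤ (U.ι ≫ Y.hom) <| by
    have := isClosedImmersion_ι hU
    exact ⟨inferInstance, inferInstance⟩

/-- The inclusion of an open and closed subscheme of a finite étale cover. -/
def FEt.restrictι (Y : FEt X) (U : Y.left.Opens) (hU : IsClosed (U : Set Y.left)) :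
    Y.restrict U hU ⟶ Y :=
  MorphismProperty.Over.homMk U.ι rfl

variable {Ω : Type u} [Field Ω]

lemma range_subset_of_mem {Y : Scheme.{u}} {U : Set Y} {y : Spec (.of Ω) ⟶ Y}
    (hy : y default ∈ U) : Set.range y ⊆ U := by
  rintro _ ⟨a, rfl⟩
  rwa [Subsingleton.elim a default]

/-- A point of an open subset, as a point of the open subscheme. -/
def liftOpens {Y : Scheme.{u}} (U : Y.Opens) (y : Spec (.of Ω) ⟶ Y) (hy : y default ∈ U) :
    Spec (.of Ω) ⟶ U :=
  IsOpenImmersion.lift U.ι y <| by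
    rw [Scheme.Opens.range_ι]
    exact range_subset_of_mem hy

lemma liftOpens_ι {Y : Scheme.{u}} (U : Y.Opens) (y : Spec (.of Ω) ⟶ Y) (hy : y default ∈ U) :
    liftOpens U y hy ≫ U.ι = y :=
  IsOpenImmersion.lift_fac _ _ _

lemma comp_ι_mem {Y : Scheme.{u}} (U : Y.Opens) (y : Spec (.of Ω) ⟶ U) :
    (y ≫ U.ι) default ∈ U := by
  rw [Scheme.Hom.comp_apply]
  exact (y default).2

/-- The fibre functor is corepresentable on `X`-schemes. -/
def fiberFunctorIso {S : Scheme.{u}} (x : S ⟶ X) :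
    MorphismProperty.Over.forget finiteEtale ⊤ X ⋙ coyoneda.obj (op (Over.mk x)) ≅
      fiberFunctor X x :=
  NatIso.ofComponents (fun _ ↦ Equiv.toIso
    { toFun q := ⟨q.left, Over.w q⟩
      invFun q := Over.homMk q.1 q.2
      left_inv _ := rfl
      right_inv _ := rfl }) fun _ ↦ rfl

instance {S : Scheme.{u}} (x : S ⟶ X) : PreservesFiniteLimits (fiberFunctor X x) :=
  preservesFiniteLimits_of_natIso (fiberFunctorIso x)

/-- Cofilteredness is what allows the compactness argument for choosing lifts of all points of all
fibres at once. -/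
instance {S : Scheme.{u}} (x : S ⟶ X) : IsCofiltered (fiberFunctor X x).Elements :=
  Functor.isCofiltered_elements _

/-- Such sections are `Ω`-algebra homomorphisms to `Ω` from a finite-dimensional algebra. -/
lemma finite_sections {T : Scheme.{u}} (q : T ⟶ Spec (.of Ω)) [IsFinite q] :
    Finite {s : Spec (.of Ω) ⟶ T // s ≫ q = 𝟙 _} := by
  have : IsAffine T := isAffine_of_isAffineHom q
  let φ : Ω →+* Γ(T, ⊤) := q.appTop.hom.comp (Scheme.ΓSpecIso (.of Ω)).inv.hom
  have hφ : φ.Finite := by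
    refine RingHom.Finite.comp (q.finite_app ⊤ (isAffineOpen_top _)) (.of_surjective _ ?_)
    exact (Scheme.ΓSpecIso (.of Ω)).symm.commRingCatIsoToRingEquiv.surjective
  let _ : Algebra Ω Γ(T, ⊤) := φ.toAlgebra
  have : Module.Finite Ω Γ(T, ⊤) := hφ
  let α : {s : Spec (.of Ω) ⟶ T // s ≫ q = 𝟙 _} → (Γ(T, ⊤) →ₐ[Ω] Ω) := fun s ↦
    { __ := (Scheme.ΓSpecIso (.of Ω)).hom.hom.comp s.1.appTop.hom
      commutes' a := by
        have h : (Scheme.ΓSpecIso (.of Ω)).inv ≫ q.appTop ≫ s.1.appTop ≫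
            (Scheme.ΓSpecIso (.of Ω)).hom = 𝟙 _ := by
          rw [← Scheme.Hom.comp_appTop_assoc, s.2, Scheme.Hom.id_appTop, Category.id_comp,
            Iso.inv_hom_id]
        exact ConcreteCategory.congr_hom h a }
  refine Finite.of_injective α fun s t hst ↦ Subtype.ext (ext_of_isAffine ?_)
  have h : s.1.appTop ≫ (Scheme.ΓSpecIso (.of Ω)).hom =
      t.1.appTop ≫ (Scheme.ΓSpecIso (.of Ω)).hom := by
    ext a
    exact DFunLike.congr_fun hst a
  exact (cancel_mono _).1 h

instance finite_fiberFunctor (x : Spec (.of Ω) ⟶ X) (Y : FEt X) :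
    Finite ((fiberFunctor X x).obj Y) := by
  have := finite_sections (pullback.snd Y.hom x)
  refine Finite.of_injective (β := {s : Spec (.of Ω) ⟶ pullback Y.hom x //
    s ≫ pullback.snd Y.hom x = 𝟙 _})
    (fun y ↦ ⟨pullback.lift y.1 (𝟙 _) (by rw [y.2, Category.id_comp]),
      pullback.lift_snd _ _ _⟩) fun y z hyz ↦ Subtype.ext ?_
  have h := congrArg (fun s ↦ s.1 ≫ pullback.fst Y.hom x) hyz
  exact (pullback.lift_fst _ _ _).symm.trans (h.trans (pullback.lift_fst _ _ _))

/-- A lift of a point of the fibre to an open and closed subscheme. -/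
def FEt.restrictLift {x : Spec (.of Ω) ⟶ X} (Y : FEt X) {U : Y.left.Opens}
    (hU : IsClosed (U : Set Y.left)) (y : (fiberFunctor X x).obj Y) (hy : y.1 default ∈ U) :
    (fiberFunctor X x).obj (Y.restrict U hU) :=
  ⟨liftOpens U y.1 hy, by
    change _ ≫ U.ι ≫ Y.hom = x
    rw [← Category.assoc, liftOpens_ι, y.2]⟩

lemma FEt.map_restrictLift {x : Spec (.of Ω) ⟶ X} (Y : FEt X) {U : Y.left.Opens}
    (hU : IsClosed (U : Set Y.left)) (y : (fiberFunctor X x).obj Y) (hy : y.1 default ∈ U) :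
    (fiberFunctor X x).map (Y.restrictι U hU) (Y.restrictLift hU y hy) = y :=
  Subtype.ext (liftOpens_ι U y.1 hy)

lemma FEt.map_restrictι_mem {x : Spec (.of Ω) ⟶ X} (Y : FEt X) {U : Y.left.Opens}
    (hU : IsClosed (U : Set Y.left)) (y : (fiberFunctor X x).obj (Y.restrict U hU)) :
    ((fiberFunctor X x).map (Y.restrictι U hU) y).1 default ∈ U := by
  exact comp_ι_mem U y.1

/-- Every endomorphism of the fibre functor is injective on fibres. -/
lemma fiberFunctor_end_injective {x : Spec (.of Ω) ⟶ X} (τ : fiberFunctor X x ⟶ fiberFunctor X x)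
    (Y : FEt X) : Function.Injective (τ.app Y) := by
  intro y z hyz
  by_contra hne
  -- The diagonal of `Y ×[X] Y` is open and closed. The pair `(y, z)` lies in its complement, and
  -- naturality keeps its image under `τ` there.
  let P : FEt X := MorphismProperty.Over.mk ⊤ (pullback.fst Y.hom Y.hom ≫ Y.hom)
    ⟨inferInstance, inferInstance⟩
  let p₁ : P ⟶ Y := MorphismProperty.Over.homMk (pullback.fst Y.hom Y.hom) rfl
  let p₂ : P ⟶ Y := MorphismProperty.Over.homMk (pullback.snd Y.hom Y.hom)
    pullback.condition.symm
  let δ := pullback.diagonal Y.hom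
  have hδ : ∀ q : Spec (.of Ω) ⟶ pullback Y.hom Y.hom,
      q default ∈ Set.range δ ↔ q ≫ pullback.fst _ _ = q ≫ pullback.snd _ _ := by
    intro q
    constructor
    · intro hq
      have h := IsOpenImmersion.lift_fac δ q (range_subset_of_mem hq)
      rw [← h, Category.assoc, Category.assoc, pullback.diagonal_fst, pullback.diagonal_snd]
    · intro hq
      have h : q = (q ≫ pullback.fst _ _) ≫ δ := by
        refine pullback.hom_ext ?_ ?_
        · rw [Category.assoc, pullback.diagonal_fst, Category.comp_id]
        · rw [Category.assoc, pullback.diagonal_snd, Category.comp_id, hq]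
      rw [h, Scheme.Hom.comp_apply]
      exact ⟨_, rfl⟩
  let U : P.left.Opens := ⟨(Set.range δ)ᶜ, δ.isClosedEmbedding.isClosed_range.isOpen_compl⟩
  have hU : IsClosed (U : Set P.left) := δ.isOpenEmbedding.isOpen_range.isClosed_compl
  let q : (fiberFunctor X x).obj P := ⟨pullback.lift y.1 z.1 (y.2.trans z.2.symm), by
    change _ ≫ pullback.fst _ _ ≫ Y.hom = x
    rw [pullback.lift_fst_assoc, y.2]⟩
  have hq : q.1 default ∈ U := by
    intro h
    have h1 := (hδ q.1).1 h
    rw [pullback.lift_fst, pullback.lift_snd] at h1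
    exact hne (Subtype.ext h1)
  have hτ : ∀ {Y Z : FEt X} (m : Y ⟶ Z) (y : (fiberFunctor X x).obj Y),
      τ.app Z ((fiberFunctor X x).map m y) = (fiberFunctor X x).map m (τ.app Y y) :=
    fun m y ↦ NatTrans.naturality_apply τ m y
  have h1 : (τ.app P q).1 default ∈ U := by
    rw [← P.map_restrictLift hU q hq, hτ]
    exact P.map_restrictι_mem hU _
  refine h1 ((hδ _).2 ?_)
  have h2 : (fiberFunctor X x).map p₁ q = y := Subtype.ext (pullback.lift_fst _ _ _)
  have h3 : (fiberFunctor X x).map p₂ q = z := Subtype.ext (pullback.lift_snd _ _ _)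
  have h4 : (fiberFunctor X x).map p₁ (τ.app P q) = (fiberFunctor X x).map p₂ (τ.app P q) := by
    rw [← hτ, ← hτ, h2, h3, hyz]
  exact congrArg Subtype.val h4

/-- An endomorphism of the fibre functor is an automorphism. -/
lemma isIso_fiberFunctor_end {x : Spec (.of Ω) ⟶ X} (τ : fiberFunctor X x ⟶ fiberFunctor X x) :
    IsIso τ := by
  have : ∀ Y, IsIso (τ.app Y) := fun Y ↦ by
    rw [isIso_iff_bijective]
    exact Finite.injective_iff_bijective.1 (fiberFunctor_end_injective τ Y)
  exact NatIso.isIso_of_isIso_app τ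

end FiniteEtale

end


/-! ### Connected base changes and surjectivity on fundamental groups -/

noncomputable section

section Surjectivity

variable {X' X : Scheme.{u}} {g : X' ⟶ X} {Ω : Type u} [Field Ω] {x : Spec (.of Ω) ⟶ X'}

/-- The map on fibres induced by a morphism between finite étale covers of `X'` and `X` that lies
over a morphism `X' ⟶ X`. -/
def fiberPush {Y : FEt X'} {Z : FEt X} (w : Y.left ⟶ Z.left) (hw : w ≫ Z.hom = Y.hom ≫ g)
    (q : (fiberFunctor X' x).obj Y) : (fiberFunctor X (x ≫ g)).obj Z :=
  ⟨q.1 ≫ w, by rw [Category.assoc, hw, ← Category.assoc, q.2]⟩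

/-- A finite étale morphism from a non-empty scheme to a connected one is surjective. -/
lemma surjective_of_isFinite_of_etale {T B : Scheme.{u}} (r : T ⟶ B) [IsFinite r] [Etale r]
    [Nonempty T] [PreconnectedSpace B] : Function.Surjective r := by
  rw [← Set.range_eq_univ]
  exact IsClopen.eq_univ ⟨r.isClosedMap.isClosed_range, r.isOpenMap.isOpen_range⟩
    (Set.range_nonempty _)

variable (σ : fiberFunctor X (x ≫ g) ⟶ fiberFunctor X (x ≫ g))

/-- By naturality, `σ` keeps the image of `y` in its connected component `C` of `Z`. The base change
of `C` to `X'` is connected, so the nonempty finite étale cover `w ⁻¹ᵁ C` surjects onto it. The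
geometric point given by `σ` and `x` therefore lifts, as `Ω` is separably closed. -/
lemma exists_fiberPush_eq [IsSepClosed Ω] [IsNoetherian X]
    (hconn : ∀ {Z : Scheme.{u}} (p : Z ⟶ X) [IsFinite p] [Etale p] [ConnectedSpace Z],
      ConnectedSpace ↥(pullback p g))
    {Y : FEt X'} (y : (fiberFunctor X' x).obj Y) {Z : FEt X} (w : Y.left ⟶ Z.left)
    (hw : w ≫ Z.hom = Y.hom ≫ g) :
    ∃ q : (fiberFunctor X' x).obj Y, fiberPush w hw q = σ.app Z (fiberPush w hw y) := by
  have : IsLocallyNoetherian Z.left := LocallyOfFiniteType.isLocallyNoetherian (Y := X) Z.hom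
  have : CompactSpace Z.left := QuasiCompact.compactSpace_of_compactSpace (Y := X) Z.hom
  have : IsNoetherian Z.left := {}
  let z := fiberPush w hw y
  let C : Z.left.Opens := ⟨connectedComponent (z.1 default),
    NoetherianSpace.isOpen_connectedComponent' _⟩
  have hC : IsClosed (C : Set Z.left) := isClosed_connectedComponent
  have : ConnectedSpace C := isConnected_iff_connectedSpace.1 isConnected_connectedComponent
  let zC : (fiberFunctor X (x ≫ g)).obj (Z.restrict C hC) :=
    Z.restrictLift hC z mem_connectedComponent
  let z' := σ.app (Z.restrict C hC) zC
  have hz' : (fiberFunctor X (x ≫ g)).map (Z.restrictι C hC) z' = σ.app Z z := by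
    rw [← Z.map_restrictLift hC z mem_connectedComponent]
    exact (NatTrans.naturality_apply σ (Z.restrictι C hC) zC).symm
  let YD := Y.restrict (w ⁻¹ᵁ C) (hC.preimage w.continuous)
  let b : C.toScheme ⟶ X := (Z.restrict C hC).hom
  have : IsFinite b := (Z.restrict C hC).prop.1
  have : Etale b := (Z.restrict C hC).prop.2
  have : ConnectedSpace ↥(pullback b g) := hconn b
  have hr : (w ∣_ C) ≫ b = (w ⁻¹ᵁ C).ι ≫ Y.hom ≫ g := by
    change (w ∣_ C) ≫ C.ι ≫ Z.hom = _
    rw [morphismRestrict_ι_assoc, hw]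
  let r : (w ⁻¹ᵁ C).toScheme ⟶ pullback b g :=
    pullback.lift (w ∣_ C) ((w ⁻¹ᵁ C).ι ≫ Y.hom) (by rw [hr, Category.assoc])
  have hrs : r ≫ pullback.snd b g = YD.hom := pullback.lift_snd _ _ _
  obtain ⟨_, _⟩ : finiteEtale r :=
    MorphismProperty.of_postcomp (W := finiteEtale) (W' := finiteEtale) r (pullback.snd b g)
      ⟨inferInstance, inferInstance⟩ (hrs ▸ YD.prop)
  have : Nonempty (w ⁻¹ᵁ C) := ⟨⟨y.1 default, by
    have h : z.1 default ∈ C := mem_connectedComponent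
    have h2 : z.1 default = w (y.1 default) := Scheme.Hom.comp_apply _ _ _
    rwa [h2] at h⟩⟩
  let c : Spec (.of Ω) ⟶ pullback b g := pullback.lift z'.1 x z'.2
  obtain ⟨t, ht⟩ := surjective_of_isFinite_of_etale r (c default)
  obtain ⟨l, hl, -⟩ := Scheme.exists_fac_of_etale_of_isSepClosed r c t ht
  refine ⟨⟨l ≫ (w ⁻¹ᵁ C).ι, ?_⟩, Subtype.ext ?_⟩
  · rw [Category.assoc]
    exact (congrArg (l ≫ ·) hrs).symm.trans
      ((Category.assoc _ _ _).symm.trans ((congrArg (· ≫ _) hl).trans (pullback.lift_snd _ _ _)))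
  · rw [← hz']
    change (l ≫ (w ⁻¹ᵁ C).ι) ≫ w = z'.1 ≫ C.ι
    have h1 : r ≫ pullback.fst b g = w ∣_ C := pullback.lift_fst _ _ _
    rw [Category.assoc, ← morphismRestrict_ι, ← h1, Category.assoc, reassoc_of% hl]
    exact (Category.assoc _ _ _).symm.trans (congrArg (· ≫ C.ι) (pullback.lift_fst _ _ _))

/-- The points of a fibre over `X'` whose images in the fibres over `X` are compatible with an
endomorphism of the fibre functor of `X`. -/
def compatiblePoints {Y : FEt X'} (y : (fiberFunctor X' x).obj Y) :
    Set ((fiberFunctor X' x).obj Y) :=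
  {q | ∀ (Z : FEt X) (w : Y.left ⟶ Z.left) (hw : w ≫ Z.hom = Y.hom ≫ g),
    fiberPush w hw q = σ.app Z (fiberPush w hw y)}

/-- Each pair `(Z, w)` imposes one satisfiable condition on a finite fibre, and fibre products of
covers make the conditions directed. A smallest solution set therefore satisfies all of them. -/
lemma nonempty_compatiblePoints [IsSepClosed Ω] [IsNoetherian X]
    (hconn : ∀ {Z : Scheme.{u}} (p : Z ⟶ X) [IsFinite p] [Etale p] [ConnectedSpace Z],
      ConnectedSpace ↥(pullback p g))
    {Y : FEt X'} (y : (fiberFunctor X' x).obj Y) : (compatiblePoints σ y).Nonempty := by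
  let I := Σ Z : FEt X, {w : Y.left ⟶ Z.left // w ≫ Z.hom = Y.hom ≫ g}
  let T : I → Set ((fiberFunctor X' x).obj Y) := fun i ↦
    {q | fiberPush i.2.1 i.2.2 q = σ.app i.1 (fiberPush i.2.1 i.2.2 y)}
  have hdir : ∀ i j, ∃ k, T k ⊆ T i ∧ T k ⊆ T j := by
    rintro ⟨Z₁, w₁, h₁⟩ ⟨Z₂, w₂, h₂⟩
    let P : FEt X := MorphismProperty.Over.mk ⊤ (pullback.fst Z₁.hom Z₂.hom ≫ Z₁.hom)
      ⟨inferInstance, inferInstance⟩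
    let p₁ : P ⟶ Z₁ := MorphismProperty.Over.homMk (pullback.fst Z₁.hom Z₂.hom) rfl
    let p₂ : P ⟶ Z₂ := MorphismProperty.Over.homMk (pullback.snd Z₁.hom Z₂.hom)
      pullback.condition.symm
    let w : Y.left ⟶ pullback Z₁.hom Z₂.hom := pullback.lift w₁ w₂ (h₁.trans h₂.symm)
    have hw : w ≫ P.hom = Y.hom ≫ g := by
      change w ≫ pullback.fst _ _ ≫ _ = _
      rw [pullback.lift_fst_assoc, h₁]
    have e₁ : ∀ q : (fiberFunctor X' x).obj Y,
        fiberPush w₁ h₁ q = (fiberFunctor X (x ≫ g)).map p₁ (fiberPush (Z := P) w hw q) := by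
      intro q
      refine Subtype.ext ?_
      change q.1 ≫ w₁ = (q.1 ≫ w) ≫ pullback.fst _ _
      rw [Category.assoc, pullback.lift_fst]
    have e₂ : ∀ q : (fiberFunctor X' x).obj Y,
        fiberPush w₂ h₂ q = (fiberFunctor X (x ≫ g)).map p₂ (fiberPush (Z := P) w hw q) := by
      intro q
      refine Subtype.ext ?_
      change q.1 ≫ w₂ = (q.1 ≫ w) ≫ pullback.snd _ _
      rw [Category.assoc, pullback.lift_snd]
    refine ⟨⟨P, w, hw⟩, fun q hq ↦ ?_, fun q hq ↦ ?_⟩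
    · change fiberPush w₁ h₁ q = σ.app Z₁ (fiberPush w₁ h₁ y)
      rw [e₁, e₁, NatTrans.naturality_apply]
      exact congrArg _ hq
    · change fiberPush w₂ h₂ q = σ.app Z₂ (fiberPush w₂ h₂ y)
      rw [e₂, e₂, NatTrans.naturality_apply]
      exact congrArg _ hq
  let i₁ : I := ⟨MorphismProperty.Over.mk ⊤ (𝟙 X) ⟨inferInstance, inferInstance⟩, Y.hom ≫ g,
    Category.comp_id _⟩
  have : Nonempty I := ⟨i₁⟩
  obtain ⟨i, hi⟩ : ∃ i, ∀ j, (T i).ncard ≤ (T j).ncard := by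
    obtain ⟨i, hi⟩ := (Set.range_nonempty fun i ↦ (T i).ncard).elim fun n hn ↦
      WellFounded.has_min Nat.lt_wfRel.wf (Set.range fun i ↦ (T i).ncard) ⟨n, hn⟩
    obtain ⟨⟨i, rfl⟩, h⟩ := hi
    exact ⟨i, fun j ↦ not_lt.1 (h _ ⟨j, rfl⟩)⟩
  obtain ⟨q, hq⟩ := exists_fiberPush_eq σ hconn y i.2.1 i.2.2
  refine ⟨q, fun Z w hw ↦ ?_⟩
  obtain ⟨k, hki, hkj⟩ := hdir i ⟨Z, w, hw⟩
  have h := Set.eq_of_subset_of_ncard_le hki (hi k)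
  exact hkj (h ▸ hq)

lemma map_mem_compatiblePoints {Y Y' : FEt X'} (m : Y ⟶ Y') {y q : (fiberFunctor X' x).obj Y}
    (hq : q ∈ compatiblePoints σ y) :
    (fiberFunctor X' x).map m q ∈ compatiblePoints σ ((fiberFunctor X' x).map m y) := by
  intro Z w hw
  have h : ∀ t : (fiberFunctor X' x).obj Y, fiberPush w hw ((fiberFunctor X' x).map m t) =
      fiberPush (g := g) (m.left ≫ w)
        (by rw [Category.assoc, hw, ← Category.assoc, MorphismProperty.Over.w]) t :=
    fun t ↦ Subtype.ext (Category.assoc _ _ _)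
  rw [h, h]
  exact hq Z _ _

/-- If base change along `g` preserves connectedness of finite étale covers, every endomorphism of
the fibre functor of `X` extends to one of the fibre functor of `X'`. -/
lemma exists_end_compatible [IsSepClosed Ω] [IsNoetherian X]
    (hconn : ∀ {Z : Scheme.{u}} (p : Z ⟶ X) [IsFinite p] [Etale p] [ConnectedSpace Z],
      ConnectedSpace ↥(pullback p g)) :
    ∃ τ : fiberFunctor X' x ⟶ fiberFunctor X' x, ∀ (Y : FEt X') (y : (fiberFunctor X' x).obj Y),
      τ.app Y y ∈ compatiblePoints σ y := by
  let S : (fiberFunctor X' x).Elements ⥤ Type u :=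
    { obj e := compatiblePoints σ e.2
      map {e e'} m := TypeCat.ofHom fun q ↦ ⟨(fiberFunctor X' x).map m.1 q.1, by
        have := map_mem_compatiblePoints σ m.1 q.2
        rwa [m.2] at this⟩
      map_id e := by
        refine ConcreteCategory.hom_ext _ _ fun q ↦ ?_
        exact Subtype.ext (ConcreteCategory.congr_hom ((fiberFunctor X' x).map_id e.1) q.1)
      map_comp m n := by
        refine ConcreteCategory.hom_ext _ _ fun q ↦ ?_
        exact Subtype.ext
          (ConcreteCategory.congr_hom ((fiberFunctor X' x).map_comp m.1 n.1) q.1) }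
  have : ∀ e, Finite (S.obj e) := fun e ↦
    inferInstanceAs (Finite (compatiblePoints σ e.2))
  have : ∀ e, Nonempty (S.obj e) := fun e ↦
    (nonempty_compatiblePoints σ hconn e.2).to_subtype
  -- A compatible family over the category of pairs `(Y, y)` is the same as a natural endomorphism
  -- of the fibre functor.
  obtain ⟨s, hs⟩ := nonempty_sections_of_finite_cofiltered_system S
  refine ⟨{ app Y := TypeCat.ofHom fun y ↦ (s ⟨Y, y⟩).1, naturality Y Y' m := ?_ },
    fun Y y ↦ (s ⟨Y, y⟩).2⟩
  ext y
  exact (congrArg Subtype.val (hs (CategoryOfElements.homMk (F := fiberFunctor X' x) ⟨Y, y⟩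
    ⟨Y', (fiberFunctor X' x).map m y⟩ m rfl))).symm

/-- If base change along `g` preserves connectedness of finite étale covers, then `g` is surjective
on étale fundamental groups. -/
theorem EtalePi1.map_surjective [IsSepClosed Ω] [IsNoetherian X]
    (hconn : ∀ {Z : Scheme.{u}} (p : Z ⟶ X) [IsFinite p] [Etale p] [ConnectedSpace Z],
      ConnectedSpace ↥(pullback p g)) : Function.Surjective (EtalePi1.map g x) := by
  intro σ
  obtain ⟨τ, hτ⟩ := exists_end_compatible σ.hom hconn
  have := isIso_fiberFunctor_end τ
  refine ⟨asIso τ, Iso.ext ?_⟩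
  ext Z z
  -- Compatibility is applied to the universal case: the base change of `Z` with its projection to
  -- `Z`.
  refine (hτ ((FEt.baseChange g).obj Z) ((fiberBaseChangeEquiv g x Z.hom).symm z) Z
    (pullback.fst Z.hom g) pullback.condition).trans ?_
  exact congrArg (σ.hom.app Z) (Subtype.ext (pullback.lift_fst _ _ _))

end Surjectivity

end

theorem corollary1p7 (A : Type u) [CommRing A] [IsDomain A] [IsLocalRing A] [IsNoetherianRing A]
    (f : A) (hf₀ : f ≠ 0) (hf : f ∈ IsLocalRing.maximalIdeal A)
    (hcomplete : IsAdicComplete (Ideal.span {f}) A)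
    (hH0 : (toGlobalPuncturedSpec A).Finite)
    (hH1 : ∃ N : ℕ, ∀ ξ : structureCohomology (puncturedSpec A).toScheme 1,
      mulStructureCohomology (toGlobalPuncturedSpec A (f ^ N)) 1 ξ = 0) :
    ConnectedSpace (puncturedSpec A).toScheme ∧
    ConnectedSpace (puncturedSpecQuotient f).toScheme ∧
    ∀ (Ω : Type u) [Field Ω] [IsSepClosed Ω]
      (x : Spec (.of Ω) ⟶ (puncturedSpecQuotient f).toScheme),
      Function.Surjective (EtalePi1.map (puncturedSpecQuotientMap f) x) := by
  have hint := isIntegral_puncturedSpec hf hf₀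
  have hV : ConnectedSpace (puncturedSpec A).toScheme := inferInstance
  have hconn := fun {Z : Scheme.{u}} (p : Z ⟶ (puncturedSpec A).toScheme) [IsFinite p] [Flat p]
    [ConnectedSpace Z] ↦ connectedSpace_reduction hf₀ hf hcomplete hH0 hH1 p
  refine ⟨hV, ?_, fun Ω _ _ x ↦ ?_⟩
  · have := hconn (𝟙 _)
    let e := asIso (pullback.snd (𝟙 (puncturedSpec A).toScheme) (puncturedSpecQuotientMap f))
    exact e.hom.homeomorph.surjective.connectedSpace e.hom.homeomorph.continuous
  · have : CompactSpace (puncturedSpec A).toScheme :=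
      isCompact_iff_compactSpace.1 (NoetherianSpace.isCompact _)
    have : IsNoetherian (puncturedSpec A).toScheme := {}
    exact EtalePi1.map_surjective fun p ↦ hconn p
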